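/- Setting. Let $F$ be a totally real number field of narrow class number $1$, and let $B$ be a quaternion algebra over $F$ that is split at exactly one archimedean place $v_\infty$ of $F$. Let $\mathfrak p$ be a finite prime of $F$, above the rational prime $p$, at which $B$ is split; let $F_{\mathfrak p}$ be the completion of $F$ at $\mathfrak p$, with ring of integers $\mathbb Z_{\mathfrak p}$, embedded in $\mathbb C_p$ as a valued field. Fix embeddings $\iota_{\mathfrak p}\colon B\hookrightarrow M_2(F_{\mathfrak p})$ and $\iota_\infty\colon B\hookrightarrow M_2(\mathbb R)$ induced by splittings of $B$ at $\mathfrak p$ and $v_\infty$, and a maximal order $R\subset B$ such that $\iota_{\mathfrak p}(R)$ generates $M_2(\mathbb Z_{\mathfrak p})$ over $\mathbb Z_{\mathfrak p}$. Let $\Gamma_0$ be the group of units of $R$ of reduced norm $1$. It acts by fractional linear transformations on the upper half plane $\mathcal H$ and on $\mathbb P^1(\mathbb R)$ through $\iota_\infty$, and on $$A_0=\{z\in\mathbb C_p : |z|\le 1 \text{ and } |z-t|\ge 1 \text{ for all } t\in\mathbb Z_{\mathfrak p}\}$$ through $\iota_{\mathfrak p}$. Let $\operatorname{Div}A_0$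 be the free abelian group on $A_0$, with the induced action of $\Gamma_0$. Let $K/F$ be a quadratic extension in which $\mathfrak p$ is inert, $v_\infty$ splits and all other archimedean places of $F$ ramify; let $\mathcal O$ be an $\mathcal O_F$-order of $K$ and $\psi\colon K\hookrightarrow B$ an embedding of $F$-algebras with $\psi^{-1}(R)=\mathcal O$. Let $u$ generate the free part of the (rank one) group of units of $\mathcal O$ of norm $1$ to $F$, and put $\gamma_\psi=\psi(u)\in\Gamma_0$. Write $\iota_\infty(\gamma_\psi)=\begin{pmatrix}a&b\\c&d\end{pmatrix}$, assume $c\ne0$, and let $$\tau_{\psi,\infty},\ \tau_{\psi,\infty}'=\frac{a-d\pm\sqrt{(d-a)^2+4bc}}{2c}$$ (with the sign $+$ for $\tau_{\psi,\infty}$ and $-$ for $\tau'_{\psi,\infty}$) be its fixed points on $\mathbb P^1(\mathbb R)$. Fix an embedding $K\hookrightarrow\mathbb C_p$ that extends $F\to F_{\mathfrak p}\to\mathbb C_p$, and assume that the point $\tau_{\psi,p}$ with $\iota_{\mathfrak p}(\psi(\alpha))\binom{\tau_{\psi,p}}{1}=\alpha\binom{\tau_{\psi,p}}{1}$ for all $\alpha\in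 K$ belongs to $A_0$. For $w\in\Gamma_0\tau_{\psi,\infty}$ choose $\gamma_w\in\Gamma_0$ with $w=\gamma_w\tau_{\psi,\infty}$, and put $w'=\gamma_w\tau_{\psi,\infty}'$ and $w_p=\gamma_w\tau_{\psi,p}\in A_0$. Let $\mathcal H^*=\mathcal H\cup\mathbb P^1(\mathbb Q)$ if $B\cong M_2(\mathbb Q)$ (with $\mathbb P^1(\mathbb Q)$ placed in $\mathbb P^1(\mathbb R)$ compatibly with $\iota_\infty$), and $\mathcal H^*=\mathcal H$ otherwise. For $a,b\in\mathcal H\cup\mathbb P^1(\mathbb R)$ let $C(a,b)$ be the oriented closed geodesic segment from $a$ to $b$. For $x\in\mathcal H^*$, $\gamma\in\Gamma_0$ and $w\in\Gamma_0\tau_{\psi,\infty}$, let $\delta_{x,\gamma}(w)\in\{-1,0,1\}$ be the signed intersection number of $C(x,\gamma x)$ and $C(w,w')$: it is $0$ if they do not meet, and otherwise $+1$ if $x$ lies to the left of $C(w,w')$ and $-1$ if it does not. Put $$\varphi_{\psi,x}(\gamma)=\sum_{w\in\Gamma_0\tau_{\psi,\infty}}\delta_{x,\gamma}(w)\cdot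 w_p .$$ Proposition. (1) The points $w'$ and $w_p$ do not depend on the choice of $\gamma_w$. (2) For all $x\in\mathcal H^*$ and $\gamma\in\Gamma_0$ there are only finitely many $w\in\Gamma_0\tau_{\psi,\infty}$ with $\delta_{x,\gamma}(w)\neq0$, so that $\varphi_{\psi,x}(\gamma)$ is a well-defined element of $\operatorname{Div}A_0$. (3) If $x\in\mathcal H^*$ lies on none of the geodesics $C(w,w')$ with $w\in\Gamma_0\tau_{\psi,\infty}$, then $\varphi_{\psi,x}$ is a $1$-cocycle: $\varphi_{\psi,x}(\gamma_1\gamma_2)=\varphi_{\psi,x}(\gamma_1)+\gamma_1\varphi_{\psi,x}(\gamma_2)$ for all $\gamma_1,\gamma_2\in\Gamma_0$. (4) The class of $\varphi_{\psi,x}$ in $H^1(\Gamma_0,\operatorname{Div}A_0)$ is the same for all base points $x$ as in (3). -/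

import Mathlib

open scoped NumberField Quaternion ENNReal
open IsDedekindDomain

noncomputable section

namespace QuatCocycle

/-! ### First group cohomology through inhomogeneous cochains -/

section Cohomology

variable {G V : Type*} [Group G] [AddCommGroup V]

/-- The group `Z¹(G, V)` of 1-cocycles: `f (gh) = f g + g • f h`. -/
def Z1 (ρ : Representation ℤ G V) : AddSubgroup (G → V) where
  carrier := {f | ∀ g h, f (g * h) = f g + ρ g (f h)}
  zero_mem' := by intro g h; simp
  add_mem' := by
    intro f₁ f₂ h₁ h₂ g h
    simp only [Pi.add_apply, h₁ g h, h₂ g h, map_add]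
    abel
  neg_mem' := by
    intro f hf g h
    simp only [Pi.neg_apply, hf g h, map_neg]
    abel

/-- The group of 1-coboundaries `g ↦ g • v - v`. -/
def B1 (ρ : Representation ℤ G V) : AddSubgroup (G → V) where
  carrier := {f | ∃ v, ∀ g, f g = ρ g v - v}
  zero_mem' := ⟨0, by simp⟩
  add_mem' := by
    rintro f₁ f₂ ⟨v₁, h₁⟩ ⟨v₂, h₂⟩
    refine ⟨v₁ + v₂, fun g => ?_⟩
    simp only [Pi.add_apply, h₁ g, h₂ g, map_add]
    abel
  neg_mem' := by
    rintro f ⟨v, hv⟩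
    refine ⟨-v, fun g => ?_⟩
    simp only [Pi.neg_apply, hv g, map_neg]
    abel

/-- `H¹(G, V)`, the quotient of the 1-cocycles by the 1-coboundaries. -/
abbrev H1 (ρ : Representation ℤ G V) : Type _ := Z1 ρ ⧸ (B1 ρ).addSubgroupOf (Z1 ρ)

/-- The cohomology class of a 1-cocycle. -/
def H1.mk (ρ : Representation ℤ G V) (f : Z1 ρ) : H1 ρ := QuotientAddGroup.mk f

end Cohomology

/-! ### Geodesics in the completed upper half plane -/

/-- `ℍ ∪ ℙ¹(ℝ)`, with its action of `GL₂(ℝ)` by fractional linear transformations. -/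
abbrev HBar : Type := UpperHalfPlane ⊕ OnePoint ℝ

/-- The geodesic from `0` to `∞`: the point `i t` for `0 < t < ∞`, and the ends `0` and `∞` for
`t = 0` and `t = ∞`. -/
def imAxis (t : ℝ≥0∞) : HBar :=
  if h : 0 < t.toReal then Sum.inl ⟨⟨0, t.toReal⟩, h⟩
  else if t = 0 then Sum.inr ((0 : ℝ) : OnePoint ℝ) else Sum.inr OnePoint.infty

/-- The (closed) geodesic segment `C(a, b)` from `a` to `b`: every oriented geodesic is the image of
the one from `0` to `∞` under an orientation preserving isometry. -/
def geodesic (a b : HBar) : Set HBar :=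
  {z | ∃ g : GL (Fin 2) ℝ, 0 < (g : Matrix (Fin 2) (Fin 2) ℝ).det ∧
    ∃ s r t : ℝ≥0∞, s ≤ r ∧ r ≤ t ∧
      g • imAxis s = a ∧ g • imAxis t = b ∧ g • imAxis r = z}

/-- The points on the left of the geodesic from `0` to `∞`. -/
def leftOfImAxis : Set HBar :=
  {z | (∃ τ : UpperHalfPlane, τ.re < 0 ∧ z = Sum.inl τ) ∨ ∃ r : ℝ, r < 0 ∧ z = Sum.inr (r : OnePoint ℝ)}

/-- The points of `ℍ ∪ ℙ¹(ℝ)` on the left of the oriented geodesic from `w` to `w'`. -/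
def leftSide (w w' : OnePoint ℝ) : Set HBar :=
  {z | ∃ g : GL (Fin 2) ℝ, 0 < (g : Matrix (Fin 2) (Fin 2) ℝ).det ∧
    g • ((0 : ℝ) : OnePoint ℝ) = w ∧ g • OnePoint.infty = w' ∧
    ∃ z₀ ∈ leftOfImAxis, g • z₀ = z}

open Classical in
/-- The signed intersection number of `C(a, b)` with `C(w, w')`, for `a` and `b` not on `C(w, w')`:
it is `0` if the two do not meet, `1` if `C(a, b)` crosses `C(w, w')` from left to right, and `-1`
if it crosses from right to left. -/
def signedIntersection (a b : HBar) (w w' : OnePoint ℝ) : ℤ :=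
  if geodesic a b ∩ geodesic (Sum.inr w) (Sum.inr w') = ∅ then 0
  else if a ∈ leftSide w w' then 1 else -1

/-! ### Orders and quaternion algebras -/

/-- `𝓞 F`-orders in a (finite dimensional) `F`-algebra. -/
def IsOrder {F A : Type*} [Field F] [NumberField F] [Ring A] [Algebra F A]
    (O : Subalgebra (𝓞 F) A) : Prop :=
  (Subalgebra.toSubmodule O).FG ∧ Submodule.span F (O : Set A) = ⊤

/-- Orders that are maximal with respect to inclusion. -/
def IsMaximalOrder {F A : Type*} [Field F] [NumberField F] [Ring A] [Algebra F A]
    (O : Subalgebra (𝓞 F) A) : Prop :=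
  IsOrder O ∧ ∀ O' : Subalgebra (𝓞 F) A, IsOrder O' → O ≤ O' → O' = O

/-- Narrow class number one: every nonzero ideal has a totally positive generator
(for totally real `F`). -/
def NarrowClassNumberOne (F : Type*) [Field F] [NumberField F] : Prop :=
  ∀ I : Ideal (𝓞 F), I ≠ ⊥ →
    ∃ α : 𝓞 F, I = Ideal.span {α} ∧ ∀ σ : F →+* ℝ, 0 < σ (α : F)

/-- The reduced norm of the quaternion algebra `(a, b)_F`. -/
def nrd {F : Type*} [Field F] {a b : F} (x : ℍ[F,a,b]) : F := (x * star x).re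

theorem nrd_one {F : Type*} [Field F] {a b : F} : nrd (1 : ℍ[F,a,b]) = 1 := by
  simp [nrd]

theorem nrd_mul {F : Type*} [Field F] {a b : F} (x y : ℍ[F,a,b]) :
    nrd (x * y) = nrd x * nrd y := by
  simp [nrd]; ring

/-- The group `R₁ˣ` of units of reduced norm one of an order `R` in `(a, b)_F`. -/
def normOneGroup {F : Type*} [Field F] [NumberField F] {a b : F}
    (R : Subalgebra (𝓞 F) ℍ[F,a,b]) : Subgroup (ℍ[F,a,b])ˣ where
  carrier := {x | (x : ℍ[F,a,b]) ∈ R ∧ ((x⁻¹ : (ℍ[F,a,b])ˣ) : ℍ[F,a,b]) ∈ R ∧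
    nrd (x : ℍ[F,a,b]) = 1}
  one_mem' := by simp [nrd_one, one_mem]
  mul_mem' := by
    rintro x y ⟨h1, h2, h3⟩ ⟨h4, h5, h6⟩
    refine ⟨?_, ?_, ?_⟩
    · rw [Units.val_mul]; exact R.mul_mem h1 h4
    · rw [mul_inv_rev, Units.val_mul]; exact R.mul_mem h5 h2
    · rw [Units.val_mul, nrd_mul, h3, h6, one_mul]
  inv_mem' := by
    rintro x ⟨h1, h2, h3⟩
    refine ⟨h2, by simpa using h1, ?_⟩
    have h := nrd_mul (x : ℍ[F,a,b]) ((x⁻¹ : (ℍ[F,a,b])ˣ) : ℍ[F,a,b])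
    rw [Units.mul_inv, nrd_one, h3, one_mul] at h
    exact h.symm

/-- The group `O₁ˣ` of units of an order `O` of `K` whose norm to `F` is one. -/
def relNormOneUnits {F K : Type*} [Field F] [NumberField F] [Field K] [Algebra F K]
    (O : Subalgebra (𝓞 F) K) : Subgroup Kˣ where
  carrier := {x | (x : K) ∈ O ∧ ((x⁻¹ : Kˣ) : K) ∈ O ∧ Algebra.norm F (x : K) = 1}
  one_mem' := by simp [one_mem]
  mul_mem' := by
    rintro x y ⟨h1, h2, h3⟩ ⟨h4, h5, h6⟩
    refine ⟨?_, ?_, ?_⟩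
    · rw [Units.val_mul]; exact O.mul_mem h1 h4
    · rw [mul_inv_rev, Units.val_mul]; exact O.mul_mem h5 h2
    · rw [Units.val_mul, map_mul, h3, h6, one_mul]
  inv_mem' := by
    rintro x ⟨h1, h2, h3⟩
    refine ⟨h2, by simpa using h1, ?_⟩
    have h := map_mul (Algebra.norm F) (x : K) ((x⁻¹ : Kˣ) : K)
    rw [Units.mul_inv, map_one, h3, one_mul] at h
    exact h.symm

/-- `u` generates the free part of the abelian group `U` of rank one: `U = U_tors × ⟨u⟩`. -/
def IsFreeGenerator {A : Type*} [CommGroup A] (U : Subgroup A) (u : A) : Prop :=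
  u ∈ U ∧ ¬ IsOfFinOrder u ∧ ∀ x ∈ U, ∃ n : ℤ, IsOfFinOrder (x * u ^ n)

/-! ### The quaternionic setting -/

/-- An almost totally definite quaternion algebra `B = (a, b)_F` over a totally real field `F` of
narrow class number one, a prime `𝔭` of `F` at which `B` splits, splittings at `𝔭` and at the split
real place, and a maximal order of `B`. -/
structure Setting (F : Type*) [Field F] [NumberField F] (p : ℕ) [Fact p.Prime] where
  totallyReal : NumberField.IsTotallyReal F
  narrow : NarrowClassNumberOne F
  a : F
  b : F
  a_ne : a ≠ 0
  b_ne : b ≠ 0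
  /-- the real place `v_∞` of `F` -/
  vInf : F →+* ℝ
  /-- `v_∞` is the only archimedean place at which `B` is split -/
  split_iff : ∀ σ : F →+* ℝ,
    Nonempty (ℍ[ℝ,σ a,σ b] ≃ₐ[ℝ] Matrix (Fin 2) (Fin 2) ℝ) ↔ σ = vInf
  /-- the finite prime `𝔭` -/
  prime : HeightOneSpectrum (𝓞 F)
  /-- the embedding of the completion of `F` at `𝔭` into `ℂ_p`, as a valued field; in particular
  `p` is the rational prime below `𝔭` -/
  emb : prime.adicCompletion F →+* ℂ_[p]
  emb_integral : ∀ t, ‖emb t‖ ≤ 1 ↔ t ∈ prime.adicCompletionIntegers F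
  /-- the embedding of `B` into `M₂(F_𝔭)`; by `F`-linearity it is induced by a splitting at `𝔭` -/
  iotaP : ℍ[F,a,b] →ₐ[F] Matrix (Fin 2) (Fin 2) (prime.adicCompletion F)
  /-- the embedding of `B` into `M₂(ℝ)`; by linearity over `v_∞` it is induced by a splitting -/
  iotaInf : ℍ[F,a,b] →+* Matrix (Fin 2) (Fin 2) ℝ
  iotaInf_scalar : ∀ c : F, iotaInf (algebraMap F ℍ[F,a,b] c) =
    algebraMap ℝ (Matrix (Fin 2) (Fin 2) ℝ) (vInf c)
  /-- the maximal order -/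
  R : Subalgebra (𝓞 F) ℍ[F,a,b]
  isMaximalOrder : IsMaximalOrder R
  /-- `R` generates `M₂(ℤ_𝔭)` over the ring of integers `ℤ_𝔭` of the completion -/
  local_eq : (Submodule.span (prime.adicCompletionIntegers F)
      ((fun x => iotaP x) '' (R : Set ℍ[F,a,b])) :
        Set (Matrix (Fin 2) (Fin 2) (prime.adicCompletion F))) =
    {M | ∀ i j, M i j ∈ prime.adicCompletionIntegers F}

namespace Setting

variable {F : Type*} [Field F] [NumberField F] {p : ℕ} [Fact p.Prime] (D : Setting F p)

/-- The quaternion algebra. -/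
abbrev B : Type _ := ℍ[F,D.a,D.b]

/-- The group `Γ₀` of units of reduced norm one of `R`. -/
abbrev Gamma0 : Subgroup (D.B)ˣ := normOneGroup D.R

/-- `Γ₀ → GL₂(ℝ)`. -/
def toGLInf : D.Gamma0 →* GL (Fin 2) ℝ :=
  (Units.map (D.iotaInf : D.B →* Matrix (Fin 2) (Fin 2) ℝ)).comp D.Gamma0.subtype

/-- The action of `Γ₀` on the upper half plane. -/
instance : MulAction D.Gamma0 UpperHalfPlane :=
  MulAction.compHom UpperHalfPlane D.toGLInf

/-- The action of `Γ₀` on `ℙ¹(ℝ)`. -/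
instance : MulAction D.Gamma0 (OnePoint ℝ) := MulAction.compHom (OnePoint ℝ) D.toGLInf

/-- `ℍ^*`: the upper half plane, together with `ℙ¹(ℚ)` if `B ≅ M₂(ℚ)`. The copy of `ℙ¹(ℚ)` in
`ℙ¹(ℝ)` is the one given by the isomorphism `B ≅ M₂(ℚ)` through `iotaInf`; it is the usual one if
`iotaInf` is the inclusion of `M₂(ℚ)` into `M₂(ℝ)`. -/
def HStar : Set HBar :=
  {x | (∃ z : UpperHalfPlane, x = Sum.inl z) ∨
    ∃ (e : D.B ≃+* Matrix (Fin 2) (Fin 2) ℚ) (g : GL (Fin 2) ℝ) (q : OnePoint ℚ),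
      (∀ y : D.B, D.iotaInf y = (g : Matrix (Fin 2) (Fin 2) ℝ) *
        (e y).map (algebraMap ℚ ℝ) * ((g⁻¹ : GL (Fin 2) ℝ) : Matrix (Fin 2) (Fin 2) ℝ)) ∧
      x = Sum.inr (g • OnePoint.map (algebraMap ℚ ℝ) q)}

/-- The principal affinoid `A₀`. -/
def A0 : Set ℂ_[p] :=
  {z | (∀ t ∈ D.prime.adicCompletionIntegers F, 1 ≤ ‖z - D.emb t‖) ∧ ‖z‖ ≤ 1}

/-- The matrix in `M₂(ℂ_p)` of an element of `B`. -/
def matP : D.B →+* Matrix (Fin 2) (Fin 2) ℂ_[p] :=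
  (RingHom.mapMatrix D.emb).comp (D.iotaP : D.B →+* _)

theorem matP_apply (x : D.B) (i j : Fin 2) : D.matP x i j = D.emb (D.iotaP x i j) := rfl

theorem norm_emb_le {x : D.B} (hx : x ∈ D.R) (i j : Fin 2) : ‖D.emb (D.iotaP x i j)‖ ≤ 1 := by
  rw [D.emb_integral]
  have h : D.iotaP x ∈ (Submodule.span (D.prime.adicCompletionIntegers F)
      ((fun x => D.iotaP x) '' (D.R : Set D.B)) :
        Set (Matrix (Fin 2) (Fin 2) (D.prime.adicCompletion F))) :=
    Submodule.subset_span ⟨x, hx, rfl⟩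
  rw [D.local_eq] at h
  exact h i j

theorem norm_sub_le_sup (x y : ℂ_[p]) : ‖x - y‖ ≤ max ‖x‖ ‖y‖ := by
  rw [sub_eq_add_neg, ← norm_neg y]
  exact IsUltrametricDist.norm_add_le_max _ _

theorem norm_mul_sub_le {a b c d : ℂ_[p]} {r : ℝ} (h1 : ‖a * b‖ ≤ r) (h2 : ‖c * d‖ ≤ r) :
    ‖a * b - c * d‖ ≤ r :=
  (norm_sub_le_sup _ _).trans (max_le h1 h2)

/-- On `A₀` a primitive integral linear form over `F_𝔭` has absolute value one. -/
theorem norm_primitive {z : ℂ_[p]} (hz : z ∈ D.A0) {c d : D.prime.adicCompletion F}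
    (hc : ‖D.emb c‖ ≤ 1) (hd : ‖D.emb d‖ ≤ 1) (h : ‖D.emb c‖ = 1 ∨ ‖D.emb d‖ = 1) :
    ‖D.emb c * z + D.emb d‖ = 1 := by
  have hcz : ‖D.emb c * z‖ ≤ 1 := by
    rw [norm_mul]; exact mul_le_one₀ hc (norm_nonneg _) hz.2
  rcases hc.eq_or_lt with hc1 | hc1
  · apply le_antisymm
    · exact (IsUltrametricDist.norm_add_le_max _ _).trans (max_le hcz hd)
    · have hc0 : D.emb c ≠ 0 := by
        intro h0; rw [h0, norm_zero] at hc1; exact zero_ne_one hc1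
      have ht : -d / c ∈ D.prime.adicCompletionIntegers F := by
        rw [← D.emb_integral, map_div₀, norm_div, hc1, div_one, map_neg, norm_neg]; exact hd
      have h3 := hz.1 _ ht
      have h4 : D.emb c * z + D.emb d = D.emb c * (z - D.emb (-d / c)) := by
        rw [map_div₀, map_neg]; field_simp; ring
      rw [h4, norm_mul, hc1, one_mul]; exact h3
  · have hd1 : ‖D.emb d‖ = 1 := h.resolve_left hc1.ne
    have hlt : ‖D.emb c * z‖ < 1 := by
      rw [norm_mul]
      exact (mul_le_of_le_one_right (norm_nonneg _) hz.2).trans_lt hc1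
    rw [IsUltrametricDist.norm_add_eq_max_of_norm_ne_norm (by rw [hd1]; exact hlt.ne), hd1]
    exact max_eq_right hlt.le

/-- A row of an integral matrix whose determinant is a unit is primitive. -/
theorem primitive_of_det {a b c d : ℂ_[p]} (ha : ‖a‖ ≤ 1) (hb : ‖b‖ ≤ 1) (hc : ‖c‖ ≤ 1)
    (hd : ‖d‖ ≤ 1) (h : ‖a * d - b * c‖ = 1) : ‖c‖ = 1 ∨ ‖d‖ = 1 := by
  by_contra hcon
  rw [not_or] at hcon
  have hc1 := lt_of_le_of_ne hc hcon.1
  have hd1 := lt_of_le_of_ne hd hcon.2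
  have h1 : ‖a * d‖ ≤ max ‖c‖ ‖d‖ := by
    rw [norm_mul]; exact (mul_le_of_le_one_left (norm_nonneg _) ha).trans (le_max_right _ _)
  have h2 : ‖b * c‖ ≤ max ‖c‖ ‖d‖ := by
    rw [norm_mul]; exact (mul_le_of_le_one_left (norm_nonneg _) hb).trans (le_max_left _ _)
  have h3 := norm_mul_sub_le h1 h2
  rw [h] at h3
  exact absurd (max_lt hc1 hd1) (not_lt.mpr h3)

theorem norm_det (γ : D.Gamma0) :
    ‖D.emb (D.iotaP (γ : (D.B)ˣ) 0 0) * D.emb (D.iotaP (γ : (D.B)ˣ) 1 1) -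
      D.emb (D.iotaP (γ : (D.B)ˣ) 0 1) * D.emb (D.iotaP (γ : (D.B)ˣ) 1 0)‖ = 1 := by
  have key : ∀ x : D.B, x ∈ D.R → ‖(D.matP x).det‖ ≤ 1 := by
    intro x hx
    rw [Matrix.det_fin_two]
    simp only [matP_apply]
    apply norm_mul_sub_le <;> rw [norm_mul] <;>
      exact mul_le_one₀ (D.norm_emb_le hx _ _) (norm_nonneg _) (D.norm_emb_le hx _ _)
  have h1 := key _ γ.2.1
  have h2 := key _ γ.2.2.1
  have h3 : (D.matP ((γ : (D.B)ˣ) : D.B)).det *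
      (D.matP (((γ : (D.B)ˣ)⁻¹ : (D.B)ˣ) : D.B)).det = 1 := by
    rw [← Matrix.det_mul, ← map_mul, Units.mul_inv, map_one, Matrix.det_one]
  have h4 : ‖(D.matP ((γ : (D.B)ˣ) : D.B)).det‖ = 1 := by
    have h5 := congrArg norm h3
    rw [norm_mul, norm_one] at h5
    nlinarith [norm_nonneg (D.matP ((γ : (D.B)ˣ) : D.B)).det,
      norm_nonneg (D.matP (((γ : (D.B)ˣ)⁻¹ : (D.B)ˣ) : D.B)).det]
  rw [Matrix.det_fin_two] at h4
  exact h4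

theorem norm_denom (γ : D.Gamma0) {z : ℂ_[p]} (hz : z ∈ D.A0) :
    ‖D.matP (γ : (D.B)ˣ) 1 0 * z + D.matP (γ : (D.B)ˣ) 1 1‖ = 1 :=
  D.norm_primitive hz (D.norm_emb_le γ.2.1 _ _) (D.norm_emb_le γ.2.1 _ _)
    (primitive_of_det (D.norm_emb_le γ.2.1 _ _) (D.norm_emb_le γ.2.1 _ _)
      (D.norm_emb_le γ.2.1 _ _) (D.norm_emb_le γ.2.1 _ _) (D.norm_det γ))

theorem denom_ne (γ : D.Gamma0) {z : ℂ_[p]} (hz : z ∈ D.A0) :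
    D.matP (γ : (D.B)ˣ) 1 0 * z + D.matP (γ : (D.B)ˣ) 1 1 ≠ 0 := by
  intro h
  have h1 := D.norm_denom γ hz
  rw [h, norm_zero] at h1
  exact zero_ne_one h1

/-- `Γ₀` preserves `A₀`. -/
theorem moebius_mem (γ : D.Gamma0) {z : ℂ_[p]} (hz : z ∈ D.A0) :
    (D.matP (γ : (D.B)ˣ) 0 0 * z + D.matP (γ : (D.B)ˣ) 0 1) /
      (D.matP (γ : (D.B)ˣ) 1 0 * z + D.matP (γ : (D.B)ˣ) 1 1) ∈ D.A0 := by
  have hR := D.norm_emb_le γ.2.1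
  have hdet := D.norm_det γ
  have hnum : ∀ t ∈ D.prime.adicCompletionIntegers F,
      ‖(D.matP (γ : (D.B)ˣ) 0 0 * z + D.matP (γ : (D.B)ˣ) 0 1) /
        (D.matP (γ : (D.B)ˣ) 1 0 * z + D.matP (γ : (D.B)ˣ) 1 1) - D.emb t‖ = 1 := by
    intro t ht
    have ht1 : ‖D.emb t‖ ≤ 1 := (D.emb_integral t).2 ht
    have hne := D.denom_ne γ hz
    have hint : ∀ i, ‖D.emb (D.iotaP (γ : (D.B)ˣ) 0 i - t * D.iotaP (γ : (D.B)ˣ) 1 i)‖ ≤ 1 := by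
      intro i
      rw [map_sub, map_mul]
      refine (norm_sub_le_sup _ _).trans (max_le (hR _ _) ?_)
      rw [norm_mul]; exact mul_le_one₀ ht1 (norm_nonneg _) (hR _ _)
    have hprim := D.norm_primitive hz (hint 0) (hint 1)
      (primitive_of_det (hR 1 0) (hR 1 1) (hint 0) (hint 1) (by
        rw [← hdet, ← norm_neg]; congr 1; simp only [map_sub, map_mul]; ring))
    have heq : (D.matP (γ : (D.B)ˣ) 0 0 * z + D.matP (γ : (D.B)ˣ) 0 1) /
        (D.matP (γ : (D.B)ˣ) 1 0 * z + D.matP (γ : (D.B)ˣ) 1 1) - D.emb t =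
        (D.emb (D.iotaP (γ : (D.B)ˣ) 0 0 - t * D.iotaP (γ : (D.B)ˣ) 1 0) * z +
          D.emb (D.iotaP (γ : (D.B)ˣ) 0 1 - t * D.iotaP (γ : (D.B)ˣ) 1 1)) /
        (D.matP (γ : (D.B)ˣ) 1 0 * z + D.matP (γ : (D.B)ˣ) 1 1) := by
      rw [eq_div_iff hne, sub_mul, div_mul_cancel₀ _ hne]
      simp only [matP_apply, map_sub, map_mul]; ring
    rw [heq, norm_div, D.norm_denom γ hz, div_one, hprim]
  refine ⟨fun t ht => (hnum t ht).ge, ?_⟩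
  have h0 := hnum 0 (zero_mem _)
  rw [map_zero, sub_zero] at h0
  exact h0.le

/-- The action of `Γ₀` on `A₀` by fractional linear transformations. -/
instance : MulAction D.Gamma0 D.A0 where
  smul γ z := ⟨_, D.moebius_mem γ z.2⟩
  one_smul z := by
    apply Subtype.ext
    change (D.matP ((1 : D.Gamma0) : (D.B)ˣ) 0 0 * z.1 + D.matP ((1 : D.Gamma0) : (D.B)ˣ) 0 1) /
      (D.matP ((1 : D.Gamma0) : (D.B)ˣ) 1 0 * z.1 + D.matP ((1 : D.Gamma0) : (D.B)ˣ) 1 1) = z.1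
    simp
  mul_smul g h z := by
    apply Subtype.ext
    change (D.matP ((g * h : D.Gamma0) : (D.B)ˣ) 0 0 * z.1 +
          D.matP ((g * h : D.Gamma0) : (D.B)ˣ) 0 1) /
        (D.matP ((g * h : D.Gamma0) : (D.B)ˣ) 1 0 * z.1 +
          D.matP ((g * h : D.Gamma0) : (D.B)ˣ) 1 1) =
      (D.matP (g : (D.B)ˣ) 0 0 * ((D.matP (h : (D.B)ˣ) 0 0 * z.1 + D.matP (h : (D.B)ˣ) 0 1) /
          (D.matP (h : (D.B)ˣ) 1 0 * z.1 + D.matP (h : (D.B)ˣ) 1 1)) + D.matP (g : (D.B)ˣ) 0 1) /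
        (D.matP (g : (D.B)ˣ) 1 0 * ((D.matP (h : (D.B)ˣ) 0 0 * z.1 + D.matP (h : (D.B)ˣ) 0 1) /
          (D.matP (h : (D.B)ˣ) 1 0 * z.1 + D.matP (h : (D.B)ˣ) 1 1)) + D.matP (g : (D.B)ˣ) 1 1)
    have h1 := D.denom_ne h z.2
    have h2 := D.denom_ne g (D.moebius_mem h z.2)
    have h3 := D.denom_ne (g * h) z.2
    rw [div_eq_div_iff h3 h2]
    simp only [Subgroup.coe_mul, Units.val_mul, map_mul, Matrix.mul_apply, Fin.sum_univ_two]
    field_simp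
    ring

theorem coe_smul_A0 (γ : D.Gamma0) (z : D.A0) : ((γ • z : D.A0) : ℂ_[p]) =
    (D.matP (γ : (D.B)ˣ) 0 0 * z + D.matP (γ : (D.B)ˣ) 0 1) /
      (D.matP (γ : (D.B)ˣ) 1 0 * z + D.matP (γ : (D.B)ˣ) 1 1) := rfl

/-- The `Γ₀`-module `Div A₀` of divisors on `A₀`. -/
def divA0 : Representation ℤ D.Gamma0 (D.A0 →₀ ℤ) where
  toFun γ := Finsupp.lmapDomain ℤ ℤ (fun z : D.A0 => γ • z)
  map_one' := by ext; simp
  map_mul' g h := by ext; simp [mul_smul]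

end Setting

/-! ### Optimal embeddings and the cocycle -/

/-- An optimal embedding `ψ` into `R` of an order of an almost totally complex quadratic extension
`K` of `F` in which `𝔭` is inert, with the fixed point `τ_{ψ,p}` in `A₀`. -/
structure OptimalEmbedding {F : Type*} [Field F] [NumberField F] {p : ℕ} [Fact p.Prime]
    (D : Setting F p) (K : Type*) [Field K] [NumberField K] [Algebra F K] where
  quadratic : Module.finrank F K = 2
  /-- `𝔭` is inert in `K` -/
  inert : (D.prime.asIdeal.map (algebraMap (𝓞 F) (𝓞 K))).IsPrime
  /-- `v_∞` splits in `K` and all other real places of `F` ramify -/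
  real_iff : ∀ σ : F →+* ℝ, (∃ τ : K →+* ℝ, τ.comp (algebraMap F K) = σ) ↔ σ = D.vInf
  O : Subalgebra (𝓞 F) K
  isOrder : IsOrder O
  psi : K →ₐ[F] D.B
  optimal : ∀ x : K, psi x ∈ D.R ↔ x ∈ O
  /-- a generator of the free part of the units of `O` of relative norm one -/
  u : Kˣ
  u_generator : IsFreeGenerator (relNormOneUnits O) u
  /-- the lower left entry of the matrix of `γ_ψ = ψ(u)` is not zero -/
  lower_left_ne : D.iotaInf (psi u) 1 0 ≠ 0
  /-- the fixed embedding of `K` into `K_𝔭 ⊆ ℂ_p` -/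
  embK : K →+* ℂ_[p]
  embK_extends : ∀ c : F,
    embK (algebraMap F K c) = D.emb (algebraMap F (D.prime.adicCompletion F) c)
  /-- the fixed point `τ_{ψ,p}` -/
  tauP : D.A0
  tauP_eigen : ∀ x : K, (D.matP (psi x)).mulVec ![(tauP : ℂ_[p]), 1] =
    embK x • ![(tauP : ℂ_[p]), 1]

namespace OptimalEmbedding

variable {F : Type*} [Field F] [NumberField F] {p : ℕ} [Fact p.Prime] {D : Setting F p}
  {K : Type*} [Field K] [NumberField K] [Algebra F K] (E : OptimalEmbedding D K)

/-- The matrix of `γ_ψ = ψ(u)` in `M₂(ℝ)`. -/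
def gammaMat : Matrix (Fin 2) (Fin 2) ℝ := D.iotaInf (E.psi E.u)

/-- The square root `√((d - a)² + 4bc)` for the matrix `(a, b; c, d)` of `γ_ψ`. -/
def sqrtDisc : ℝ :=
  √((E.gammaMat 1 1 - E.gammaMat 0 0) ^ 2 + 4 * E.gammaMat 0 1 * E.gammaMat 1 0)

/-- The fixed point `τ_{ψ,∞}` of `γ_ψ`. -/
def tau : OnePoint ℝ :=
  ((E.gammaMat 0 0 - E.gammaMat 1 1 + E.sqrtDisc) / (2 * E.gammaMat 1 0) : ℝ)

/-- The other fixed point of `γ_ψ` on `ℙ¹(ℝ)`. -/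
def tauConj : OnePoint ℝ :=
  ((E.gammaMat 0 0 - E.gammaMat 1 1 - E.sqrtDisc) / (2 * E.gammaMat 1 0) : ℝ)

/-- The orbit `Γ₀ τ_{ψ,∞}`. -/
abbrev Orbit : Set (OnePoint ℝ) := MulAction.orbit D.Gamma0 E.tau

/-- An element `γ_w` of `Γ₀` with `γ_w τ_{ψ,∞} = w`. -/
def rep (w : E.Orbit) : D.Gamma0 := (MulAction.mem_orbit_iff.mp w.2).choose

theorem rep_smul (w : E.Orbit) : E.rep w • E.tau = w :=
  (MulAction.mem_orbit_iff.mp w.2).choose_spec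

/-- The other end `w' = γ_w τ'_{ψ,∞}` of the geodesic attached to `w`. -/
def conj (w : E.Orbit) : OnePoint ℝ := E.rep w • E.tauConj

/-- The point `w_p = γ_w τ_{ψ,p}` of `A₀`. -/
def pt (w : E.Orbit) : D.A0 := E.rep w • E.tauP

/-- `δ_γ(w)`, the signed intersection number of `C(x, γ x)` and `C(w, w')`. -/
def delta (x : HBar) (γ : D.Gamma0) (w : E.Orbit) : ℤ :=
  signedIntersection x (γ • x) w (E.conj w)

/-- `φ_ψ(γ) = ∑_w δ_γ(w) · w_p`, a sum over the orbit of `τ_{ψ,∞}`. -/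
def phi (x : HBar) (γ : D.Gamma0) : D.A0 →₀ ℤ :=
  ∑ᶠ w : E.Orbit, E.delta x γ w • Finsupp.single (E.pt w) 1

/-- The base points: the points of `ℍ^*` that lie on none of the geodesics `C(w, w')`. -/
def BasePoints : Set HBar :=
  {x | x ∈ D.HStar ∧ ∀ w : E.Orbit, x ∉ geodesic (Sum.inr (w : OnePoint ℝ)) (Sum.inr (E.conj w))}

end OptimalEmbedding

end QuatCocycle

end

/-!
To the point `w = γ_w τ_{ψ,∞}` belongs the element `β_w = γ_w ψ(u) γ_w⁻¹` of the order `R`. Its real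
matrix is hyperbolic with fixed points `w` and `w'`, and the larger eigenvalue belongs to `w`. A
real matrix `M` defines a Hermitian form `v ↦ Re det (conj v, M v)` on homogeneous coordinates. For the
matrix of `β_w` the zeros of this form on `ℍ ∪ ℙ¹(ℝ)` are the points of `C(w, w')`, and it is
negative exactly on the left of `C(w, w')` (`IsHyperbolic.mem_geodesic_iff`,
`IsHyperbolic.mem_leftSide_iff`).

Along a segment of the imaginary axis the form is linear in suitable coordinates, so a segment whose
ends do not lie on `C(w, w')` meets `C(w, w')` if and only if its ends lie on different sides. Hence
the signed intersection number of `C(x, y)` with `C(w, w')` is `L_w(x) - L_w(y)`, where `L_w` is the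
indicator function of the left side (`IsHyperbolic.signedIntersection_eq`), and `φ_{ψ,x}(γ)` is
`S(x, γ x)` with `S(x, y) = ∑_w (L_w(x) - L_w(y)) w_p` (`crossSum`). As
`S(x, y) + S(y, z) = S(x, z)` and `γ S(x, y) = S(γ x, γ y)`, the function `φ_{ψ,x}` is a cocycle,
and `φ_{ψ,x}` and `φ_{ψ,y}` differ by the coboundary of `S(x, y)`.

The points `w'` and `w_p` are well defined because the stabilizer of `τ_{ψ,∞}` commutes with `ψ(u)`:
an element of `B` that kills an eigenvector of `ψ(u)` is zero, as the eigenvalues of `ψ(u)` do not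
lie in `F` (`eq_zero_of_mulVec_eq_zero`).

The sums are finite (`finite_formQ_mul_nonpos`) by the following argument. If `C(w, w')` separates
`x` from `y`, move these points to `i s` and `i t` on the imaginary axis. The separation bounds the
entries of the matrix of `β_w`, since its trace and determinant do not depend on `w`. If `x` or `y`
is a cusp, this also needs that the form of `β_w` takes there a nonzero value in a fixed lattice in
`ℝ` (`isSeparated_of_mem_HStar`). At the real places other than `v_∞` the algebra `B` is definite,
so `β_w` is bounded there by its reduced norm. So the conjugates of the coordinates of `β_w` are
bounded, their denominators are bounded as `β_w` lies in `R`, and there are finitely many such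
elements (`finite_of_nrd_eq`).
-/

noncomputable section

namespace QuatCocycle

open Matrix ComplexConjugate

/-! ### Homogeneous coordinates and the quadratic form of a matrix -/

/-- Homogeneous coordinates of a point of the projective line: `(t, 1)` for a finite point `t`
and `(1, 0)` for `∞`. -/
def lineVec {k : Type*} [Field k] (x : OnePoint k) : Fin 2 → k :=
  x.elim ![1, 0] fun t => ![t, 1]

@[simp] theorem lineVec_infty {k : Type*} [Field k] :
    lineVec (OnePoint.infty : OnePoint k) = ![1, 0] := rfl

@[simp] theorem lineVec_coe {k : Type*} [Field k] (t : k) :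
    lineVec (t : OnePoint k) = ![t, 1] := rfl

theorem lineVec_ne_zero {k : Type*} [Field k] (x : OnePoint k) : lineVec x ≠ 0 := by
  intro h
  induction x using OnePoint.rec with
  | infty => simpa using congrFun h 0
  | coe t => simpa using congrFun h 1

theorem lineVec_map (q : OnePoint ℚ) (i : Fin 2) :
    lineVec (OnePoint.map (algebraMap ℚ ℝ) q) i = ((lineVec q i : ℚ) : ℝ) := by
  induction q using OnePoint.rec with
  | infty => fin_cases i <;> simp
  | coe t => fin_cases i <;> simp [OnePoint.map_some]

theorem eq_of_lineVec_eq_smul {k : Type*} [Field k] {x y : OnePoint k} {c : k}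
    (h : lineVec x = c • lineVec y) : x = y := by
  have h0 := congrFun h 0
  have h1 := congrFun h 1
  induction x using OnePoint.rec with
  | infty =>
    induction y using OnePoint.rec with
    | infty => rfl
    | coe t => simp at h0 h1; simp [← h1] at h0
  | coe s =>
    induction y using OnePoint.rec with
    | infty => simp at h1
    | coe t => simp at h0 h1; rw [h0, ← h1, one_mul]

theorem mulVec_lineVec (g : GL (Fin 2) ℝ) (x : OnePoint ℝ) :
    ∃ k : ℝ, k ≠ 0 ∧ (g : Matrix (Fin 2) (Fin 2) ℝ) *ᵥ lineVec x = k • lineVec (g • x) := by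
  have hdet := g.det_ne_zero
  rw [det_fin_two] at hdet
  induction x using OnePoint.rec with
  | infty =>
    rw [OnePoint.smul_infty_eq_ite]
    split_ifs with h
    · refine ⟨g 0 0, fun h0 => hdet (by simp [h0, h]), ?_⟩
      ext i; fin_cases i <;> simp [h]
    · refine ⟨g 1 0, h, ?_⟩
      ext i; fin_cases i <;> simp [mul_div_cancel₀, h]
  | coe t =>
    rw [OnePoint.smul_some_eq_ite]
    split_ifs with h
    · refine ⟨g 0 0 * t + g 0 1, fun h0 => hdet ?_, ?_⟩
      · by_cases hc : g 1 0 = 0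
        · simp [hc] at h; simp [hc, h]
        · have : g 1 0 * (g 0 0 * g 1 1 - g 0 1 * g 1 0) = 0 := by
            linear_combination g 1 0 * g 0 0 * h - g 1 0 * g 1 0 * h0
          exact (mul_eq_zero.1 this).resolve_left hc
      · ext i; fin_cases i <;> simp [h]
    · refine ⟨g 1 0 * t + g 1 1, h, ?_⟩
      ext i; fin_cases i <;> simp [mul_div_cancel₀, h]

/-- For `x = y`: a point of the projective line is fixed by `g` if and only if its homogeneous
coordinates are an eigenvector of `g`. -/
theorem smul_eq_iff (g : GL (Fin 2) ℝ) (x y : OnePoint ℝ) :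
    g • x = y ↔ ∃ k : ℝ, (g : Matrix (Fin 2) (Fin 2) ℝ) *ᵥ lineVec x = k • lineVec y := by
  obtain ⟨k, hk, h⟩ := mulVec_lineVec g x
  constructor
  · rintro rfl; exact ⟨k, h⟩
  · rintro ⟨l, hl⟩
    apply eq_of_lineVec_eq_smul (c := k⁻¹ * l)
    rw [mul_smul, ← hl, h, smul_smul, inv_mul_cancel₀ hk, one_smul]

/-- Complex homogeneous coordinates of a point of `ℍ ∪ ℙ¹(ℝ)`. -/
def HBar.vec : HBar → Fin 2 → ℂ
  | Sum.inl z => ![z, 1]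
  | Sum.inr x => fun i => ((lineVec x i : ℝ) : ℂ)

/-- The product of a real matrix and a complex vector. -/
def cMulVec (M : Matrix (Fin 2) (Fin 2) ℝ) (v : Fin 2 → ℂ) : Fin 2 → ℂ :=
  ![M 0 0 * v 0 + M 0 1 * v 1, M 1 0 * v 0 + M 1 1 * v 1]

theorem eq_of_vec_eq_smul {x y : HBar} {c : ℂ} (h : x.vec = c • y.vec) : x = y := by
  have h0 := congrFun h 0
  have h1 := congrFun h 1
  rcases x with z | x <;> rcases y with w | y <;>
    simp only [HBar.vec, Pi.smul_apply, smul_eq_mul, cons_val_zero, cons_val_one] at h0 h1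
  · rw [mul_one] at h1
    rw [← h1, one_mul] at h0
    rw [UpperHalfPlane.ext h0]
  · exfalso
    induction y using OnePoint.rec with
    | infty => simp at h1
    | coe t =>
      simp only [lineVec_coe, cons_val_one, cons_val_zero, Complex.ofReal_one, mul_one] at h0 h1
      rw [← h1, one_mul] at h0
      have := congrArg Complex.im h0
      rw [Complex.ofReal_im] at this
      exact z.im_ne_zero this
  · exfalso
    rw [mul_one] at h1
    rw [← h1] at h0
    have h2 := congrArg Complex.im h0
    rw [Complex.im_ofReal_mul, Complex.ofReal_im, eq_comm, mul_eq_zero] at h2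
    have h3 := h2.resolve_right w.im_ne_zero
    apply lineVec_ne_zero x
    ext i
    fin_cases i
    · simpa [h3] using h0
    · simpa using h3
  · congr 1
    by_cases hc : (lineVec y 1) = 0
    · rw [hc] at h1
      simp only [Complex.ofReal_zero, mul_zero, Complex.ofReal_eq_zero] at h1
      induction x using OnePoint.rec with
      | coe t => simp at h1
      | infty =>
        induction y using OnePoint.rec with
        | coe t => simp at hc
        | infty => rfl
    · apply eq_of_lineVec_eq_smul (c := lineVec x 1 / lineVec y 1)
      have hc' : ((lineVec y 1 : ℝ) : ℂ) ≠ 0 := by exact_mod_cast hc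
      have h2 : c = ((lineVec x 1 / lineVec y 1 : ℝ) : ℂ) := by
        push_cast; rw [h1]; field_simp
      rw [h2] at h0 h1
      ext i
      fin_cases i
      · simp only [Fin.zero_eta, Pi.smul_apply, smul_eq_mul]
        exact_mod_cast h0
      · simp only [Fin.mk_one, Pi.smul_apply, smul_eq_mul]
        exact_mod_cast h1

theorem cMulVec_vec_inr (g : GL (Fin 2) ℝ) (x : OnePoint ℝ) :
    ∃ k : ℝ, k ≠ 0 ∧
      cMulVec g (HBar.vec (Sum.inr x)) = (k : ℂ) • HBar.vec (Sum.inr (g • x)) := by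
  obtain ⟨k, hk, h⟩ := mulVec_lineVec g x
  refine ⟨k, hk, ?_⟩
  have h0 := congrFun h 0
  have h1 := congrFun h 1
  simp only [mulVec_fin_two, cons_val_zero, cons_val_one, Pi.smul_apply, smul_eq_mul] at h0 h1
  ext i
  fin_cases i
  · simp only [cMulVec, HBar.vec, Fin.zero_eta, cons_val_zero, Pi.smul_apply, smul_eq_mul]
    exact_mod_cast h0
  · simp only [cMulVec, HBar.vec, Fin.mk_one, cons_val_one, Pi.smul_apply, smul_eq_mul,
      cons_val_zero]
    exact_mod_cast h1

theorem cMulVec_vec {g : GL (Fin 2) ℝ} (hg : 0 < (g : Matrix (Fin 2) (Fin 2) ℝ).det) (z : HBar) :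
    ∃ k : ℂ, k ≠ 0 ∧ cMulVec g z.vec = k • (g • z).vec := by
  rcases z with z | x
  · refine ⟨UpperHalfPlane.denom g z, UpperHalfPlane.denom_ne_zero g z, ?_⟩
    have h := UpperHalfPlane.coe_smul_of_det_pos (g := g) (by simpa using hg) z
    have hd := UpperHalfPlane.denom_ne_zero g z
    rw [Sum.smul_inl]
    ext i
    fin_cases i
    · simp only [cMulVec, HBar.vec, Fin.zero_eta, cons_val_zero, cons_val_one, Pi.smul_apply,
        smul_eq_mul, h, mul_div_cancel₀ _ hd, mul_one]
      rfl
    · simp [cMulVec, HBar.vec, UpperHalfPlane.denom]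
  · obtain ⟨k, hk, h⟩ := cMulVec_vec_inr g x
    exact ⟨k, by exact_mod_cast hk, h⟩

/-- The real part of `det (conj v, M v)`. It is a Hermitian form in `v`, whose zeros on `ℍ ∪ ℙ¹(ℝ)`
are the closed geodesic between the real fixed points of `M`. -/
def hForm (M : Matrix (Fin 2) (Fin 2) ℝ) (v : Fin 2 → ℂ) : ℝ :=
  (conj (v 0) * cMulVec M v 1 - conj (v 1) * cMulVec M v 0).re

/-- The value of `hForm M` at the standard homogeneous coordinates of a point. -/
def formQ (M : Matrix (Fin 2) (Fin 2) ℝ) (z : HBar) : ℝ := hForm M z.vec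

theorem hForm_smul (M : Matrix (Fin 2) (Fin 2) ℝ) (k : ℂ) (v : Fin 2 → ℂ) :
    hForm M (k • v) = Complex.normSq k * hForm M v := by
  simp only [hForm, cMulVec, Pi.smul_apply, smul_eq_mul, map_mul, cons_val_zero, cons_val_one,
    Complex.sub_re, Complex.mul_re, Complex.add_re, Complex.mul_im, Complex.add_im,
    Complex.conj_re, Complex.conj_im, Complex.ofReal_re, Complex.ofReal_im, Complex.normSq_apply]
  ring

theorem hForm_cMulVec {M N g : Matrix (Fin 2) (Fin 2) ℝ} (h : N * g = g * M) (v : Fin 2 → ℂ) :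
    hForm N (cMulVec g v) = g.det * hForm M v := by
  have e (i j) : (N * g) i j = (g * M) i j := by rw [h]
  have key : cMulVec N (cMulVec g v) = cMulVec g (cMulVec M v) := by
    have e' (i j) : (N i 0 * g 0 j + N i 1 * g 1 j : ℂ) = g i 0 * M 0 j + g i 1 * M 1 j := by
      have := e i j
      simp only [mul_apply, Fin.sum_univ_two] at this
      exact_mod_cast this
    ext i
    fin_cases i
    · simp only [cMulVec, Fin.zero_eta, cons_val_zero, cons_val_one]
      linear_combination v 0 * e' 0 0 + v 1 * e' 0 1
    · simp only [cMulVec, Fin.mk_one, cons_val_zero, cons_val_one]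
      linear_combination v 0 * e' 1 0 + v 1 * e' 1 1
  have : conj (cMulVec g v 0) * cMulVec N (cMulVec g v) 1 -
      conj (cMulVec g v 1) * cMulVec N (cMulVec g v) 0 =
      (g.det : ℂ) * (conj (v 0) * cMulVec M v 1 - conj (v 1) * cMulVec M v 0) := by
    rw [key, det_fin_two]
    simp only [cMulVec, cons_val_zero, cons_val_one, map_add, map_mul, Complex.conj_ofReal]
    push_cast
    ring
  rw [hForm, this, Complex.re_ofReal_mul, hForm]

/-- Equivariance of `formQ`: conjugating the matrix and moving the point changes the value by a
positive factor that depends only on `g` and the point. -/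
theorem formQ_smul {g : GL (Fin 2) ℝ} (hg : 0 < (g : Matrix (Fin 2) (Fin 2) ℝ).det) (z : HBar) :
    ∃ k : ℝ, 0 < k ∧ ∀ M N : Matrix (Fin 2) (Fin 2) ℝ, N * g = g * M →
      formQ N (g • z) = k * formQ M z := by
  obtain ⟨k, hk, h⟩ := cMulVec_vec hg z
  have hk' := Complex.normSq_pos.2 hk
  refine ⟨(g : Matrix (Fin 2) (Fin 2) ℝ).det / Complex.normSq k, div_pos hg hk', ?_⟩
  intro M N hMN
  have h1 := hForm_cMulVec hMN z.vec
  rw [h, hForm_smul] at h1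
  rw [formQ, formQ, div_mul_eq_mul_div, eq_div_iff hk'.ne', ← h1, mul_comm]

/-- On the boundary the sign of the determinant of `g` does not matter, except for the sign of
the factor. -/
theorem formQ_smul_inr (g : GL (Fin 2) ℝ) (x : OnePoint ℝ) :
    ∃ k : ℝ, k ≠ 0 ∧ ∀ M N : Matrix (Fin 2) (Fin 2) ℝ, N * g = g * M →
      formQ N (Sum.inr (g • x)) = k * formQ M (Sum.inr x) := by
  obtain ⟨k, hk, h'⟩ := cMulVec_vec_inr g x
  have hk' : Complex.normSq k ≠ 0 := (Complex.normSq_pos.2 (by exact_mod_cast hk)).ne'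
  refine ⟨(g : Matrix (Fin 2) (Fin 2) ℝ).det / Complex.normSq k,
    div_ne_zero g.det_ne_zero hk', ?_⟩
  intro M N hMN
  have h1 := hForm_cMulVec hMN (HBar.vec (Sum.inr x))
  rw [h', hForm_smul] at h1
  rw [formQ, formQ, div_mul_eq_mul_div, eq_div_iff hk', ← h1, mul_comm]

theorem formQ_inl (M : Matrix (Fin 2) (Fin 2) ℝ) (z : UpperHalfPlane) :
    formQ M (Sum.inl z) =
      M 1 0 * (z.re ^ 2 + z.im ^ 2) + (M 1 1 - M 0 0) * z.re - M 0 1 := by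
  simp [formQ, hForm, cMulVec, HBar.vec]
  ring

theorem formQ_inr (M : Matrix (Fin 2) (Fin 2) ℝ) (x : OnePoint ℝ) :
    formQ M (Sum.inr x) = M 1 0 * lineVec x 0 ^ 2 + (M 1 1 - M 0 0) * (lineVec x 0 * lineVec x 1)
      - M 0 1 * lineVec x 1 ^ 2 := by
  simp [formQ, hForm, cMulVec, HBar.vec]
  ring

theorem exists_eigen_of_form_eq_zero {k : Type*} [Field k] (M : Matrix (Fin 2) (Fin 2) k)
    (x : OnePoint k) (h : M 1 0 * lineVec x 0 ^ 2 + (M 1 1 - M 0 0) * (lineVec x 0 * lineVec x 1)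
      - M 0 1 * lineVec x 1 ^ 2 = 0) : ∃ μ : k, M *ᵥ lineVec x = μ • lineVec x := by
  induction x using OnePoint.rec with
  | infty =>
    simp only [lineVec_infty, cons_val_zero, cons_val_one] at h
    refine ⟨M 0 0, ?_⟩
    ext i; fin_cases i
    · simp
    · simpa using h
  | coe t =>
    simp only [lineVec_coe, cons_val_zero, cons_val_one] at h
    refine ⟨M 1 0 * t + M 1 1, ?_⟩
    ext i; fin_cases i
    · simp; linear_combination -h
    · simp

theorem formQ_neg (M : Matrix (Fin 2) (Fin 2) ℝ) (z : HBar) : formQ (-M) z = -formQ M z := by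
  rcases z with z | x
  · simp only [formQ_inl, Matrix.neg_apply]; ring
  · simp only [formQ_inr, Matrix.neg_apply]; ring

/-! ### Geodesics as zero sets -/

/-- The real part of `p * conj q` for the standard homogeneous coordinates `(p, q)` of a point; its
sign tells on which side of the imaginary axis the point lies. -/
def HBar.side : HBar → ℝ
  | Sum.inl z => z.re
  | Sum.inr x => lineVec x 0 * lineVec x 1

theorem formQ_diag (μ μ' : ℝ) (z : HBar) : formQ !![μ', 0; 0, μ] z = (μ - μ') * z.side := by
  rcases z with z | x
  · simp [formQ_inl, HBar.side]
  · simp [formQ_inr, HBar.side]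

theorem imAxis_zero : imAxis 0 = Sum.inr ((0 : ℝ) : OnePoint ℝ) := by simp [imAxis]

theorem imAxis_top : imAxis ⊤ = Sum.inr OnePoint.infty := by simp [imAxis]

theorem imAxis_of_pos {r : ℝ≥0∞} (h : 0 < r.toReal) : imAxis r = Sum.inl ⟨⟨0, r.toReal⟩, h⟩ := by
  simp [imAxis, h]

theorem eq_zero_or_top_or_pos (r : ℝ≥0∞) : r = 0 ∨ r = ⊤ ∨ 0 < r.toReal := by
  rcases eq_or_ne r 0 with h | h
  · exact Or.inl h
  · rcases eq_or_ne r ⊤ with h' | h'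
    · exact Or.inr (Or.inl h')
    · exact Or.inr (Or.inr (ENNReal.toReal_pos h h'))

theorem side_eq_zero_iff (z : HBar) : z.side = 0 ↔ ∃ r, imAxis r = z := by
  constructor
  · intro h
    rcases z with z | x
    · refine ⟨ENNReal.ofReal z.im, ?_⟩
      have h1 : (ENNReal.ofReal z.im).toReal = z.im := ENNReal.toReal_ofReal z.im_pos.le
      rw [imAxis_of_pos (by rw [h1]; exact z.im_pos)]
      congr 1
      apply UpperHalfPlane.ext
      apply Complex.ext
      · exact h.symm
      · exact h1
    · induction x using OnePoint.rec with
      | infty => exact ⟨⊤, imAxis_top⟩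
      | coe t =>
        refine ⟨0, ?_⟩
        rw [imAxis_zero]
        simp [HBar.side] at h
        rw [h]
  · rintro ⟨r, rfl⟩
    rcases eq_zero_or_top_or_pos r with rfl | rfl | h
    · simp [imAxis_zero, HBar.side]
    · simp [imAxis_top, HBar.side]
    · rw [imAxis_of_pos h]; rfl

theorem mem_leftOfImAxis_iff (z : HBar) : z ∈ leftOfImAxis ↔ z.side < 0 := by
  constructor
  · rintro (⟨τ, h, rfl⟩ | ⟨r, h, rfl⟩)
    · exact h
    · simpa [HBar.side] using h
  · intro h
    rcases z with z | x
    · exact Or.inl ⟨z, h, rfl⟩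
    · induction x using OnePoint.rec with
      | infty => simp [HBar.side] at h
      | coe t => exact Or.inr ⟨t, by simpa [HBar.side] using h, rfl⟩

/-- A matrix with prescribed nonzero columns moves `0` and `∞` to any two distinct points; the
sign of one column makes its determinant positive. -/
theorem exists_frame {w w' : OnePoint ℝ} (h : w ≠ w') :
    ∃ g : GL (Fin 2) ℝ, 0 < (g : Matrix (Fin 2) (Fin 2) ℝ).det ∧
      g • ((0 : ℝ) : OnePoint ℝ) = w ∧ g • OnePoint.infty = w' := by
  set v := lineVec w with hv
  set v' := lineVec w' with hv'
  have hd : v' 0 * v 1 - v 0 * v' 1 ≠ 0 := by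
    intro h0
    apply h
    induction w using OnePoint.rec with
    | infty =>
      induction w' using OnePoint.rec with
      | infty => rfl
      | coe t => simp [hv, hv'] at h0
    | coe s =>
      induction w' using OnePoint.rec with
      | infty => simp [hv, hv'] at h0
      | coe t => simp [hv, hv'] at h0; rw [sub_eq_zero.1 h0]
  obtain ⟨ε, hε⟩ : ∃ ε : ℝ, 0 < ε * (v' 0 * v 1 - v 0 * v' 1) :=
    ⟨v' 0 * v 1 - v 0 * v' 1, mul_self_pos.2 hd⟩
  have hdet : (!![ε * v' 0, v 0; ε * v' 1, v 1] : Matrix (Fin 2) (Fin 2) ℝ).det =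
      ε * (v' 0 * v 1 - v 0 * v' 1) := by
    rw [det_fin_two_of]; ring
  refine ⟨GeneralLinearGroup.mkOfDetNeZero !![ε * v' 0, v 0; ε * v' 1, v 1]
    (by rw [hdet]; exact hε.ne'), ?_, ?_, ?_⟩
  · change 0 < (!![ε * v' 0, v 0; ε * v' 1, v 1] : Matrix (Fin 2) (Fin 2) ℝ).det
    rw [hdet]; exact hε
  · rw [smul_eq_iff]
    refine ⟨1, ?_⟩
    change (!![ε * v' 0, v 0; ε * v' 1, v 1] : Matrix (Fin 2) (Fin 2) ℝ) *ᵥ _ = _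
    ext i; fin_cases i <;> simp [v]
  · rw [smul_eq_iff]
    refine ⟨ε, ?_⟩
    change (!![ε * v' 0, v 0; ε * v' 1, v 1] : Matrix (Fin 2) (Fin 2) ℝ) *ᵥ _ = _
    ext i; fin_cases i <;> simp [v']

/-- `M` is hyperbolic with fixed points `w` and `w'`, and `w` belongs to the larger eigenvalue. -/
structure IsHyperbolic (M : Matrix (Fin 2) (Fin 2) ℝ) (w w' : OnePoint ℝ) (μ μ' : ℝ) : Prop where
  lt : μ' < μ
  eigen : M *ᵥ lineVec w = μ • lineVec w
  eigen' : M *ᵥ lineVec w' = μ' • lineVec w'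

section Hyperbolic

variable {M : Matrix (Fin 2) (Fin 2) ℝ} {w w' : OnePoint ℝ} {μ μ' : ℝ}

theorem IsHyperbolic.ne (h : IsHyperbolic M w w' μ μ') : w ≠ w' := by
  rintro rfl
  have h1 := h.eigen.symm.trans h.eigen'
  rw [← sub_eq_zero, ← sub_smul] at h1
  rcases smul_eq_zero.1 h1 with h2 | h2
  · linarith [h.lt]
  · exact lineVec_ne_zero _ h2

/-- In a basis of eigenvectors a hyperbolic matrix is diagonal. -/
theorem IsHyperbolic.conj (h : IsHyperbolic M w w' μ μ') {g : GL (Fin 2) ℝ}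
    (h0 : g • ((0 : ℝ) : OnePoint ℝ) = w) (h1 : g • OnePoint.infty = w') :
    M * (g : Matrix (Fin 2) (Fin 2) ℝ) = g * !![μ', 0; 0, μ] := by
  obtain ⟨k, hk⟩ := (smul_eq_iff _ _ _).1 h0
  obtain ⟨l, hl⟩ := (smul_eq_iff _ _ _).1 h1
  have e1 : M *ᵥ ((g : Matrix (Fin 2) (Fin 2) ℝ) *ᵥ lineVec ((0 : ℝ) : OnePoint ℝ)) =
      μ • ((g : Matrix (Fin 2) (Fin 2) ℝ) *ᵥ lineVec ((0 : ℝ) : OnePoint ℝ)) := by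
    rw [hk, mulVec_smul, h.eigen, smul_comm]
  have e2 : M *ᵥ ((g : Matrix (Fin 2) (Fin 2) ℝ) *ᵥ lineVec OnePoint.infty) =
      μ' • ((g : Matrix (Fin 2) (Fin 2) ℝ) *ᵥ lineVec OnePoint.infty) := by
    rw [hl, mulVec_smul, h.eigen', smul_comm]
  have a0 := congrFun e1 0
  have a1 := congrFun e1 1
  have b0 := congrFun e2 0
  have b1 := congrFun e2 1
  simp at a0 a1 b0 b1
  ext i j
  fin_cases i <;> fin_cases j <;> simp [mul_apply, Fin.sum_univ_two, *, mul_comm]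

theorem IsHyperbolic.formQ_eq (h : IsHyperbolic M w w' μ μ') {g : GL (Fin 2) ℝ}
    (hg : 0 < (g : Matrix (Fin 2) (Fin 2) ℝ).det)
    (h0 : g • ((0 : ℝ) : OnePoint ℝ) = w) (h1 : g • OnePoint.infty = w') (z : HBar) :
    ∃ k : ℝ, 0 < k ∧ formQ M (g • z) = k * z.side := by
  obtain ⟨k, hk, hf⟩ := formQ_smul hg z
  refine ⟨k * (μ - μ'), mul_pos hk (sub_pos.2 h.lt), ?_⟩
  rw [hf _ _ (h.conj h0 h1), formQ_diag, mul_assoc]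

theorem IsHyperbolic.mem_leftSide_iff (h : IsHyperbolic M w w' μ μ') (z : HBar) :
    z ∈ leftSide w w' ↔ formQ M z < 0 := by
  constructor
  · rintro ⟨g, hg, h0, h1, z₀, hz₀, rfl⟩
    obtain ⟨k, hk, hf⟩ := h.formQ_eq hg h0 h1 z₀
    rw [hf]
    exact mul_neg_of_pos_of_neg hk ((mem_leftOfImAxis_iff _).1 hz₀)
  · intro hz
    obtain ⟨g, hg, h0, h1⟩ := exists_frame h.ne
    obtain ⟨k, hk, hf⟩ := h.formQ_eq hg h0 h1 (g⁻¹ • z)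
    rw [smul_inv_smul] at hf
    refine ⟨g, hg, h0, h1, g⁻¹ • z, (mem_leftOfImAxis_iff _).2 ?_, smul_inv_smul _ _⟩
    rw [hf] at hz
    exact (pos_iff_neg_of_mul_neg hz).1 hk

theorem IsHyperbolic.exists_imAxis (h : IsHyperbolic M w w' μ μ') {z : HBar} (hz : formQ M z = 0)
    {g : GL (Fin 2) ℝ} (hg : 0 < (g : Matrix (Fin 2) (Fin 2) ℝ).det)
    (h0 : g • ((0 : ℝ) : OnePoint ℝ) = w) (h1 : g • OnePoint.infty = w') :
    ∃ r, g • imAxis r = z := by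
  obtain ⟨k, hk, hf⟩ := h.formQ_eq hg h0 h1 (g⁻¹ • z)
  rw [smul_inv_smul, hz, eq_comm, mul_eq_zero] at hf
  obtain ⟨r, hr⟩ := (side_eq_zero_iff _).1 (hf.resolve_left hk.ne')
  exact ⟨r, by rw [hr, smul_inv_smul]⟩

theorem imAxis_eq_inr {s : ℝ≥0∞} {g : GL (Fin 2) ℝ} {w : OnePoint ℝ}
    (h : g • imAxis s = Sum.inr w) : s = 0 ∨ s = ⊤ := by
  rcases eq_zero_or_top_or_pos s with h1 | h1 | h1
  · exact Or.inl h1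
  · exact Or.inr h1
  · rw [imAxis_of_pos h1, Sum.smul_inl] at h
    cases h

theorem IsHyperbolic.mem_geodesic_iff (h : IsHyperbolic M w w' μ μ') (z : HBar) :
    z ∈ geodesic (Sum.inr w) (Sum.inr w') ↔ formQ M z = 0 := by
  constructor
  · rintro ⟨g, hg, s, r, t, hsr, hrt, hs, ht, rfl⟩
    have hst : s ≠ t := by
      rintro rfl
      exact h.ne (Sum.inr_injective (hs.symm.trans ht))
    have h1 : s = 0 ∧ t = ⊤ := by
      have hle := hsr.trans hrt
      rcases imAxis_eq_inr hs with rfl | rfl <;> rcases imAxis_eq_inr ht with rfl | rfl <;> simp_all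
    obtain ⟨rfl, rfl⟩ := h1
    rw [imAxis_zero, Sum.smul_inr] at hs
    rw [imAxis_top, Sum.smul_inr] at ht
    obtain ⟨k, hk, hf⟩ := h.formQ_eq hg (Sum.inr_injective hs) (Sum.inr_injective ht) (imAxis r)
    rw [hf, (side_eq_zero_iff _).2 ⟨r, rfl⟩, mul_zero]
  · intro hz
    obtain ⟨g, hg, h0, h1⟩ := exists_frame h.ne
    obtain ⟨r, hr⟩ := h.exists_imAxis hz hg h0 h1
    exact ⟨g, hg, 0, r, ⊤, bot_le, le_top, by rw [imAxis_zero, Sum.smul_inr, h0],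
      by rw [imAxis_top, Sum.smul_inr, h1], hr⟩

end Hyperbolic

/-! ### Geodesic segments and the sign of the form at their ends -/

/-- The squared absolute values `(|p|², |q|²)` of homogeneous coordinates `(p, q)` of `imAxis r`. -/
def axisCoord (r : ℝ≥0∞) : ℝ × ℝ := if r = ⊤ then (1, 0) else (r.toReal ^ 2, 1)

theorem formQ_imAxis (M : Matrix (Fin 2) (Fin 2) ℝ) (r : ℝ≥0∞) :
    formQ M (imAxis r) = M 1 0 * (axisCoord r).1 - M 0 1 * (axisCoord r).2 := by
  rcases eq_zero_or_top_or_pos r with rfl | rfl | h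
  · simp [imAxis_zero, formQ_inr, axisCoord]
  · simp [imAxis_top, formQ_inr, axisCoord]
  · have : r ≠ ⊤ := by rintro rfl; simp at h
    rw [imAxis_of_pos h, formQ_inl, axisCoord, if_neg this]
    change M 1 0 * ((0 : ℝ) ^ 2 + r.toReal ^ 2) + (M 1 1 - M 0 0) * 0 - M 0 1 = _
    ring

/-- The coordinates of a point of a segment of the imaginary axis lie in the cone spanned by those
of its ends. -/
theorem axisCoord_between {s r t : ℝ≥0∞} (hsr : s ≤ r) (hrt : r ≤ t) :
    ∃ α β : ℝ, 0 ≤ α ∧ 0 ≤ β ∧ 0 < α + β ∧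
      axisCoord r = α • axisCoord s + β • axisCoord t := by
  rcases eq_or_ne r ⊤ with rfl | hr
  · obtain rfl : t = ⊤ := top_le_iff.1 hrt
    exact ⟨0, 1, le_rfl, zero_le_one, by norm_num, by simp⟩
  have hs : s ≠ ⊤ := ne_top_of_le_ne_top hr hsr
  have h1 : s.toReal ≤ r.toReal := (ENNReal.toReal_le_toReal hs hr).2 hsr
  have h0 : 0 ≤ s.toReal := ENNReal.toReal_nonneg
  have h2 : s.toReal ^ 2 ≤ r.toReal ^ 2 := by gcongr
  rcases eq_or_ne t ⊤ with rfl | ht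
  · refine ⟨1, r.toReal ^ 2 - s.toReal ^ 2, zero_le_one, by linarith, by linarith, ?_⟩
    simp [axisCoord, hr, hs]
  have h3 : r.toReal ≤ t.toReal := (ENNReal.toReal_le_toReal hr ht).2 hrt
  have h4 : r.toReal ^ 2 ≤ t.toReal ^ 2 := by gcongr
  rcases eq_or_lt_of_le (h2.trans h4) with h5 | h5
  · refine ⟨1, 0, zero_le_one, le_rfl, by norm_num, ?_⟩
    simp only [axisCoord, hr, hs, if_false, one_smul, zero_smul, add_zero, Prod.mk.injEq, and_true]
    linarith
  · have h6 : 0 < t.toReal ^ 2 - s.toReal ^ 2 := sub_pos.2 h5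
    refine ⟨(t.toReal ^ 2 - r.toReal ^ 2) / (t.toReal ^ 2 - s.toReal ^ 2),
      (r.toReal ^ 2 - s.toReal ^ 2) / (t.toReal ^ 2 - s.toReal ^ 2),
      div_nonneg (by linarith) h6.le, div_nonneg (by linarith) h6.le, ?_, ?_⟩
    · rw [← add_div]
      exact div_pos (by linarith) h6
    · simp only [axisCoord, hr, hs, ht, if_false, Prod.smul_mk, smul_eq_mul, Prod.mk_add_mk,
        Prod.mk.injEq]
      constructor <;> field_simp <;> ring

/-- If `formQ M` is positive at both ends of a segment, then it is positive on the segment. -/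
theorem formQ_pos_of_mem_geodesic {M : Matrix (Fin 2) (Fin 2) ℝ} {a b z : HBar}
    (ha : 0 < formQ M a) (hb : 0 < formQ M b) (hz : z ∈ geodesic a b) : 0 < formQ M z := by
  obtain ⟨g, hg, s, r, t, hsr, hrt, rfl, rfl, rfl⟩ := hz
  have hMg : M * (g : Matrix (Fin 2) (Fin 2) ℝ) = g * ((g⁻¹ : GL (Fin 2) ℝ) * M * g) := by
    rw [← mul_assoc, ← mul_assoc, Units.mul_inv, one_mul]
  obtain ⟨k₁, hk₁, e₁⟩ := formQ_smul hg (imAxis s)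
  obtain ⟨k₂, hk₂, e₂⟩ := formQ_smul hg (imAxis r)
  obtain ⟨k₃, hk₃, e₃⟩ := formQ_smul hg (imAxis t)
  rw [e₁ _ _ hMg, formQ_imAxis] at ha
  rw [e₃ _ _ hMg, formQ_imAxis] at hb
  rw [e₂ _ _ hMg, formQ_imAxis]
  have ha' := (pos_iff_pos_of_mul_pos ha).1 hk₁
  have hb' := (pos_iff_pos_of_mul_pos hb).1 hk₃
  obtain ⟨α, β, hα, hβ, hαβ, h⟩ := axisCoord_between hsr hrt
  apply mul_pos hk₂
  rw [h]
  simp only [Prod.fst_add, Prod.snd_add, Prod.smul_fst, Prod.smul_snd, smul_eq_mul]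
  set N := ((g⁻¹ : GL (Fin 2) ℝ) : Matrix (Fin 2) (Fin 2) ℝ) * M * g
  have e : N 1 0 * (α * (axisCoord s).1 + β * (axisCoord t).1) -
      N 0 1 * (α * (axisCoord s).2 + β * (axisCoord t).2) =
      α * (N 1 0 * (axisCoord s).1 - N 0 1 * (axisCoord s).2) +
      β * (N 1 0 * (axisCoord t).1 - N 0 1 * (axisCoord t).2) := by ring
  rw [e]
  rcases hα.eq_or_lt with h0 | h0
  · have : 0 < β := by linarith
    rw [← h0]; simpa using mul_pos this hb'
  · exact add_pos_of_pos_of_nonneg (mul_pos h0 ha') (mul_nonneg hβ hb'.le)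

/-- A segment that meets a geodesic has its ends on different (closed) sides of it. -/
theorem formQ_mul_nonpos_of_mem_geodesic {M : Matrix (Fin 2) (Fin 2) ℝ} {a b z : HBar}
    (hz : z ∈ geodesic a b) (h : formQ M z = 0) : formQ M a * formQ M b ≤ 0 := by
  by_contra! hc
  rcases pos_and_pos_or_neg_and_neg_of_mul_pos hc with ⟨h1, h2⟩ | ⟨h1, h2⟩
  · exact (formQ_pos_of_mem_geodesic h1 h2 hz).ne' h
  · have h3 := formQ_pos_of_mem_geodesic (M := -M) (by rw [formQ_neg]; linarith)
      (by rw [formQ_neg]; linarith) hz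
    rw [formQ_neg, h] at h3
    simp at h3

/-- A linear form in `(|p|², |q|²)` that changes its sign between two points of the imaginary axis
vanishes between them. -/
theorem exists_axis_zero {M : Matrix (Fin 2) (Fin 2) ℝ} {s t : ℝ≥0∞} (hst : s ≤ t)
    (hs : formQ M (imAxis s) < 0) (ht : 0 < formQ M (imAxis t)) :
    ∃ r, s ≤ r ∧ r ≤ t ∧ formQ M (imAxis r) = 0 := by
  rw [formQ_imAxis] at hs ht
  have hs' : s ≠ ⊤ := by
    rintro rfl
    obtain rfl : t = ⊤ := top_le_iff.1 hst
    linarith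
  have h0 : 0 ≤ s.toReal := ENNReal.toReal_nonneg
  simp only [axisCoord, hs', if_false, mul_one] at hs
  have hc : 0 < M 1 0 := by
    rcases eq_or_ne t ⊤ with rfl | ht'
    · simpa [axisCoord] using ht
    · simp only [axisCoord, ht', if_false, mul_one] at ht
      by_contra! hc
      have h3 : s.toReal ≤ t.toReal := (ENNReal.toReal_le_toReal hs' ht').2 hst
      have h4 : s.toReal ^ 2 ≤ t.toReal ^ 2 := by gcongr
      nlinarith
  have hb : 0 < M 0 1 := by nlinarith [mul_nonneg hc.le (sq_nonneg s.toReal)]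
  have hq : 0 < M 0 1 / M 1 0 := div_pos hb hc
  refine ⟨ENNReal.ofReal √(M 0 1 / M 1 0), ?_, ?_, ?_⟩
  · rw [ENNReal.le_ofReal_iff_toReal_le hs' (Real.sqrt_nonneg _)]
    apply Real.le_sqrt_of_sq_le
    rw [le_div_iff₀ hc]; linarith
  · rcases eq_or_ne t ⊤ with rfl | ht'
    · exact le_top
    · simp only [axisCoord, ht', if_false, mul_one] at ht
      rw [ENNReal.ofReal_le_iff_le_toReal ht', Real.sqrt_le_left ENNReal.toReal_nonneg,
        div_le_iff₀ hc]
      linarith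
  · rw [formQ_imAxis]
    simp only [axisCoord, ENNReal.ofReal_ne_top, if_false, mul_one,
      ENNReal.toReal_ofReal (Real.sqrt_nonneg _), Real.sq_sqrt hq.le]
    field_simp
    ring

/-- The rotation by a right angle reverses the imaginary axis. -/
theorem exists_flip : ∃ g : GL (Fin 2) ℝ, 0 < (g : Matrix (Fin 2) (Fin 2) ℝ).det ∧
    ∀ r : ℝ≥0∞, g • imAxis r⁻¹ = imAxis r := by
  have hdet : (!![0, -1; 1, 0] : Matrix (Fin 2) (Fin 2) ℝ).det = 1 := by simp
  let g : GL (Fin 2) ℝ := GeneralLinearGroup.mkOfDetNeZero !![0, -1; 1, 0] (by rw [hdet]; simp)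
  have hg : 0 < (g : Matrix (Fin 2) (Fin 2) ℝ).det := by
    change 0 < (!![0, -1; 1, 0] : Matrix (Fin 2) (Fin 2) ℝ).det
    rw [hdet]; exact one_pos
  refine ⟨g, hg, fun r => ?_⟩
  obtain ⟨k, hk, h⟩ := cMulVec_vec hg (imAxis r⁻¹)
  have h00 : (g : Matrix (Fin 2) (Fin 2) ℝ) 0 0 = 0 := rfl
  have h01 : (g : Matrix (Fin 2) (Fin 2) ℝ) 0 1 = -1 := rfl
  have h10 : (g : Matrix (Fin 2) (Fin 2) ℝ) 1 0 = 1 := rfl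
  have h11 : (g : Matrix (Fin 2) (Fin 2) ℝ) 1 1 = 0 := rfl
  have key : ∃ l : ℂ, cMulVec g (imAxis r⁻¹).vec = l • (imAxis r).vec := by
    simp only [cMulVec, h00, h01, h10, h11]
    rcases eq_zero_or_top_or_pos r with rfl | rfl | hr
    · refine ⟨1, ?_⟩
      ext i; fin_cases i <;> simp [imAxis_zero, imAxis_top, HBar.vec]
    · refine ⟨-1, ?_⟩
      ext i; fin_cases i <;> simp [imAxis_zero, imAxis_top, HBar.vec]
    · have hr' : 0 < (r⁻¹).toReal := by rw [ENNReal.toReal_inv]; positivity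
      rw [imAxis_of_pos hr, imAxis_of_pos hr']
      refine ⟨Complex.I * (r⁻¹).toReal, ?_⟩
      have e : ∀ (y : ℝ) (hy : 0 < y),
          HBar.vec (Sum.inl ⟨⟨0, y⟩, hy⟩) = ![(y : ℂ) * Complex.I, 1] := by
        intro y hy
        ext i; fin_cases i
        · apply Complex.ext <;> simp [HBar.vec]
        · simp [HBar.vec]
      rw [e, e]
      have hrc : (r.toReal : ℂ) ≠ 0 := by exact_mod_cast hr.ne'
      ext i; fin_cases i
      · simp only [ENNReal.toReal_inv, Complex.ofReal_inv]
        simp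
        field_simp
        simp
      · simp [mul_comm]
  obtain ⟨l, hl⟩ := key
  rw [h] at hl
  apply eq_of_vec_eq_smul (c := k⁻¹ * l)
  rw [mul_smul, ← hl, smul_smul, inv_mul_cancel₀ hk, one_smul]

/-- Two points on a common geodesic are joined by one of its segments. -/
theorem exists_segment_of_frame {g : GL (Fin 2) ℝ} (hg : 0 < (g : Matrix (Fin 2) (Fin 2) ℝ).det)
    (s t : ℝ≥0∞) : ∃ h : GL (Fin 2) ℝ, 0 < (h : Matrix (Fin 2) (Fin 2) ℝ).det ∧
      ∃ s' t' : ℝ≥0∞, s' ≤ t' ∧ h • imAxis s' = g • imAxis s ∧ h • imAxis t' = g • imAxis t := by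
  rcases le_total s t with hst | hst
  · exact ⟨g, hg, s, t, hst, rfl, rfl⟩
  · obtain ⟨k, hk, hf⟩ := exists_flip
    refine ⟨g * k, ?_, s⁻¹, t⁻¹, ENNReal.inv_le_inv.2 hst, ?_, ?_⟩
    · rw [Units.val_mul, det_mul]; exact mul_pos hg hk
    · rw [mul_smul, hf]
    · rw [mul_smul, hf]

/-- Any two points lie on a common geodesic: a vertical line, or the half circle whose centre on
the real line has the same distance from both. -/
theorem exists_hyperbolic_through (a b : HBar) :
    ∃ M w w' μ μ', IsHyperbolic M w w' μ μ' ∧ formQ M a = 0 ∧ formQ M b = 0 := by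
  have vert (X : ℝ) : IsHyperbolic !![-1, 2 * X; 0, 1] (X : OnePoint ℝ) OnePoint.infty 1 (-1) := by
    refine ⟨by norm_num, ?_, ?_⟩
    · ext i; fin_cases i
      · simp; ring
      · simp
    · ext i; fin_cases i <;> simp
  have circ (m : ℝ) {r : ℝ} (hr : 0 < r) : IsHyperbolic !![m, r ^ 2 - m ^ 2; 1, -m]
      ((m + r : ℝ) : OnePoint ℝ) ((m - r : ℝ) : OnePoint ℝ) r (-r) := by
    refine ⟨by linarith, ?_, ?_⟩
    · ext i; fin_cases i
      · simp; ring
      · simp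
    · ext i; fin_cases i
      · simp; ring
      · simp; ring
  -- a finite point has coordinates `X = Re z` and `P = |z|²`, with equality in `X² ≤ P` on the
  -- boundary only
  have coords (z : HBar) : z = Sum.inr OnePoint.infty ∨ ∃ X P : ℝ, X ^ 2 ≤ P ∧
      (∀ M : Matrix (Fin 2) (Fin 2) ℝ, formQ M z = M 1 0 * P + (M 1 1 - M 0 0) * X - M 0 1) := by
    rcases z with z | x
    · exact Or.inr ⟨z.re, z.re ^ 2 + z.im ^ 2, by nlinarith [sq_nonneg z.im],
        fun M => formQ_inl M z⟩
    · induction x using OnePoint.rec with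
      | infty => exact Or.inl rfl
      | coe t =>
        refine Or.inr ⟨t, t ^ 2, le_rfl, fun M => ?_⟩
        rw [formQ_inr]; simp
  have hinf (X : ℝ) : formQ !![-1, 2 * X; 0, 1] (Sum.inr OnePoint.infty) = 0 := by
    simp [formQ_inr]
  rcases coords a with rfl | ⟨X, P, hP, ha⟩
  · rcases coords b with rfl | ⟨X', P', hP', hb⟩
    · exact ⟨_, _, _, _, _, vert 0, hinf 0, hinf 0⟩
    · refine ⟨_, _, _, _, _, vert X', hinf X', ?_⟩
      rw [hb]; simp; ring
  · rcases coords b with rfl | ⟨X', P', hP', hb⟩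
    · refine ⟨_, _, _, _, _, vert X, ?_, hinf X⟩
      rw [ha]; simp; ring
    · rcases eq_or_ne X X' with rfl | hX
      · refine ⟨_, _, _, _, _, vert X, ?_, ?_⟩
        · rw [ha]; simp; ring
        · rw [hb]; simp; ring
      · have hX' : X - X' ≠ 0 := sub_ne_zero.2 hX
        set m := (P - P') / (2 * (X - X')) with hm
        have hm' : P - 2 * m * X = P' - 2 * m * X' := by rw [hm]; field_simp; ring
        have hpos : 0 < P - 2 * m * X + m ^ 2 := by
          rcases eq_or_ne m X with h | h
          · have h2 : m ≠ X' := by rw [h]; exact hX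
            rw [hm']
            have := sq_pos_of_pos (abs_pos.2 (sub_ne_zero.2 h2))
            rw [sq_abs] at this
            nlinarith
          · have := sq_pos_of_pos (abs_pos.2 (sub_ne_zero.2 h))
            rw [sq_abs] at this
            nlinarith
        refine ⟨_, _, _, _, _, circ m (Real.sqrt_pos.2 hpos), ?_, ?_⟩
        · rw [ha, Real.sq_sqrt hpos.le]; simp; ring
        · rw [hb, Real.sq_sqrt hpos.le]; simp; linarith

/-- Any two points are joined by a geodesic segment. -/
theorem exists_segment (a b : HBar) :
    ∃ g : GL (Fin 2) ℝ, 0 < (g : Matrix (Fin 2) (Fin 2) ℝ).det ∧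
      ∃ s t : ℝ≥0∞, s ≤ t ∧ g • imAxis s = a ∧ g • imAxis t = b := by
  obtain ⟨M, w, w', μ, μ', h, ha, hb⟩ := exists_hyperbolic_through a b
  obtain ⟨g, hg, h0, h1⟩ := exists_frame h.ne
  obtain ⟨s, rfl⟩ := h.exists_imAxis ha hg h0 h1
  obtain ⟨t, rfl⟩ := h.exists_imAxis hb hg h0 h1
  exact exists_segment_of_frame hg s t

/-- A segment whose ends lie strictly on different sides of a geodesic meets it. -/
theorem exists_mem_geodesic_formQ_eq_zero {M : Matrix (Fin 2) (Fin 2) ℝ} {a b : HBar}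
    (h : formQ M a * formQ M b < 0) : ∃ z ∈ geodesic a b, formQ M z = 0 := by
  obtain ⟨g, hg, s, t, hst, rfl, rfl⟩ := exists_segment a b
  set N := ((g⁻¹ : GL (Fin 2) ℝ) : Matrix (Fin 2) (Fin 2) ℝ) * M * g with hN
  have hMg : M * (g : Matrix (Fin 2) (Fin 2) ℝ) = g * N := by
    rw [hN, ← mul_assoc, ← mul_assoc, Units.mul_inv, one_mul]
  obtain ⟨k₁, hk₁, e₁⟩ := formQ_smul hg (imAxis s)
  obtain ⟨k₃, hk₃, e₃⟩ := formQ_smul hg (imAxis t)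
  rw [e₁ _ _ hMg, e₃ _ _ hMg, mul_mul_mul_comm] at h
  have h' := (pos_iff_neg_of_mul_neg h).1 (mul_pos hk₁ hk₃)
  obtain ⟨r, hsr, hrt, hr⟩ : ∃ r, s ≤ r ∧ r ≤ t ∧ formQ N (imAxis r) = 0 := by
    rcases mul_neg_iff.1 h' with ⟨h1, h2⟩ | ⟨h1, h2⟩
    · obtain ⟨r, hsr, hrt, hr⟩ := exists_axis_zero (M := -N) hst
        (by rw [formQ_neg]; linarith) (by rw [formQ_neg]; linarith)
      exact ⟨r, hsr, hrt, by rw [formQ_neg] at hr; linarith⟩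
    · exact exists_axis_zero hst h1 h2
  obtain ⟨k₂, hk₂, e₂⟩ := formQ_smul hg (imAxis r)
  exact ⟨g • imAxis r, ⟨g, hg, s, r, t, hsr, hrt, rfl, rfl, rfl⟩, by rw [e₂ _ _ hMg, hr, mul_zero]⟩

/-- The indicator function of the half plane where `formQ M` is negative, which is the left side
of the geodesic. -/
def leftIndicator (M : Matrix (Fin 2) (Fin 2) ℝ) (z : HBar) : ℤ := if formQ M z < 0 then 1 else 0

section Intersection

variable {M : Matrix (Fin 2) (Fin 2) ℝ} {w w' : OnePoint ℝ} {μ μ' : ℝ}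

theorem IsHyperbolic.formQ_mul_nonpos (h : IsHyperbolic M w w' μ μ') {a b : HBar}
    (hne : signedIntersection a b w w' ≠ 0) : formQ M a * formQ M b ≤ 0 := by
  rw [signedIntersection] at hne
  split_ifs at hne with h1
  · exact absurd rfl hne
  all_goals
    obtain ⟨z, hz, hz'⟩ := Set.nonempty_iff_ne_empty.2 h1
    exact formQ_mul_nonpos_of_mem_geodesic hz ((h.mem_geodesic_iff z).1 hz')

/-- Off the geodesic the signed intersection number is a difference of values of one function. -/
theorem IsHyperbolic.signedIntersection_eq (h : IsHyperbolic M w w' μ μ') {a b : HBar}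
    (ha : formQ M a ≠ 0) (hb : formQ M b ≠ 0) :
    signedIntersection a b w w' = leftIndicator M a - leftIndicator M b := by
  rw [signedIntersection, leftIndicator, leftIndicator]
  have hab := mul_ne_zero ha hb
  by_cases h1 : geodesic a b ∩ geodesic (Sum.inr w) (Sum.inr w') = ∅
  · rw [if_pos h1]
    have h2 : 0 < formQ M a * formQ M b := by
      by_contra! hc
      obtain ⟨z, hz, hz0⟩ := exists_mem_geodesic_formQ_eq_zero (lt_of_le_of_ne hc hab)
      exact (Set.eq_empty_iff_forall_notMem.1 h1) z ⟨hz, (h.mem_geodesic_iff z).2 hz0⟩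
    rcases pos_and_pos_or_neg_and_neg_of_mul_pos h2 with ⟨h3, h4⟩ | ⟨h3, h4⟩
    · rw [if_neg h3.not_gt, if_neg h4.not_gt, sub_zero]
    · rw [if_pos h3, if_pos h4, sub_self]
  · rw [if_neg h1, h.mem_leftSide_iff]
    obtain ⟨z, hz, hz'⟩ := Set.nonempty_iff_ne_empty.2 h1
    have h2 := lt_of_le_of_ne
      (formQ_mul_nonpos_of_mem_geodesic hz ((h.mem_geodesic_iff z).1 hz')) hab
    rcases mul_neg_iff.1 h2 with ⟨h3, h4⟩ | ⟨h3, h4⟩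
    · rw [if_neg h3.not_gt, if_neg h3.not_gt, if_pos h4, zero_sub]
    · rw [if_pos h3, if_pos h3, if_neg h4.not_gt, sub_zero]

end Intersection

/-! ### Two-dimensional representations of a quaternion algebra -/

section Representation

variable {F L : Type*} [Field F] [Field L] {a b : F}

theorem algebraMap_add_star (x : ℍ[F,a,b]) : algebraMap F ℍ[F,a,b] (2 * x.re) = x + star x := by
  ext <;> simp [two_mul]

theorem mul_star_eq_nrd (x : ℍ[F,a,b]) : x * star x = algebraMap F ℍ[F,a,b] (nrd x) := by
  ext <;> simp [nrd] <;> ring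

theorem star_mul_eq_nrd (x : ℍ[F,a,b]) : star x * x = algebraMap F ℍ[F,a,b] (nrd x) := by
  ext <;> simp [nrd] <;> ring

theorem nrd_eq (x : ℍ[F,a,b]) : nrd x =
    x.re ^ 2 - a * x.imI ^ 2 - b * x.imJ ^ 2 + a * b * x.imK ^ 2 := by
  simp [nrd]; ring

/-- Every ring homomorphism from a quaternion algebra to `2 × 2` matrices over a field preserves
traces: `i`, `j` and `ij` anticommute with an invertible element, so their matrices have trace
zero. -/
theorem trace_map [CharZero L] (ha : a ≠ 0) (hb : b ≠ 0) (φ : ℍ[F,a,b] →+* Matrix (Fin 2) (Fin 2) L)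
    (φ₀ : F →+* L) (h : ∀ c, φ (algebraMap F _ c) = φ₀ c • 1) (x : ℍ[F,a,b]) :
    (φ x).trace = φ₀ (2 * x.re) := by
  have key (y z : ℍ[F,a,b]) (c : F) (hc : c ≠ 0) (hz : z * z = algebraMap F _ c)
      (hyz : z * y = -(y * z)) : (φ y).trace = 0 := by
    have h1 : (φ (z * y * z)).trace = φ₀ c * (φ y).trace := by
      rw [map_mul, trace_mul_comm, ← map_mul, ← mul_assoc, hz, map_mul, h, smul_mul_assoc, one_mul,
        trace_smul, smul_eq_mul]
    have h2 : (φ (z * y * z)).trace = -(φ₀ c * (φ y).trace) := by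
      rw [hyz, neg_mul, mul_assoc, hz, map_neg, map_mul, h, mul_smul_comm, mul_one, trace_neg,
        trace_smul, smul_eq_mul]
    have h3 : φ₀ c * (φ y).trace = 0 := by
      rw [h1] at h2
      exact self_eq_neg.1 h2
    exact (mul_eq_zero.1 h3).resolve_left ((map_ne_zero φ₀).2 hc)
  have hi := key ⟨0, 1, 0, 0⟩ ⟨0, 0, 1, 0⟩ b hb (by ext <;> simp) (by ext <;> simp)
  have hj := key ⟨0, 0, 1, 0⟩ ⟨0, 1, 0, 0⟩ a ha (by ext <;> simp) (by ext <;> simp)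
  have hk := key ⟨0, 0, 0, 1⟩ ⟨0, 1, 0, 0⟩ a ha (by ext <;> simp) (by ext <;> simp)
  have hx : x = algebraMap F _ x.re + algebraMap F _ x.imI * ⟨0, 1, 0, 0⟩ +
      algebraMap F _ x.imJ * ⟨0, 0, 1, 0⟩ + algebraMap F _ x.imK * ⟨0, 0, 0, 1⟩ := by
    ext <;> simp
  conv_lhs => rw [hx]
  simp only [map_add, map_mul, h, smul_mul_assoc, one_mul, trace_add, trace_smul, hi, hj, hk,
    mul_zero, add_zero, trace_one, Fintype.card_fin, smul_eq_mul]
  rw [map_ofNat, mul_comm, Nat.cast_ofNat]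

theorem map_star [CharZero L] (ha : a ≠ 0) (hb : b ≠ 0) (φ : ℍ[F,a,b] →+* Matrix (Fin 2) (Fin 2) L)
    (φ₀ : F →+* L) (h : ∀ c, φ (algebraMap F _ c) = φ₀ c • 1) (x : ℍ[F,a,b]) :
    φ (star x) = (φ x).adjugate := by
  have h1 : φ (star x) = (φ x).trace • 1 - φ x := by
    rw [trace_map ha hb φ φ₀ h, ← h, algebraMap_add_star, map_add, add_sub_cancel_left]
  rw [h1, adjugate_fin_two, trace_fin_two]
  ext i j
  fin_cases i <;> fin_cases j <;> simp

theorem det_map [CharZero L] (ha : a ≠ 0) (hb : b ≠ 0) (φ : ℍ[F,a,b] →+* Matrix (Fin 2) (Fin 2) L)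
    (φ₀ : F →+* L) (h : ∀ c, φ (algebraMap F _ c) = φ₀ c • 1) (x : ℍ[F,a,b]) :
    (φ x).det = φ₀ (nrd x) := by
  have h1 : φ x * φ (star x) = φ₀ (nrd x) • 1 := by rw [← map_mul, mul_star_eq_nrd, h]
  rw [map_star ha hb φ φ₀ h, mul_adjugate] at h1
  simpa using congrFun (congrFun h1 0) 0

/-- The trace form of a quaternion algebra is nondegenerate. -/
theorem eq_zero_of_forall_re_mul [CharZero F] (ha : a ≠ 0) (hb : b ≠ 0) {x : ℍ[F,a,b]}
    (h : ∀ y : ℍ[F,a,b], (x * y).re = 0) : x = 0 := by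
  have h0 := h 1
  have h1 := h ⟨0, 1, 0, 0⟩
  have h2 := h ⟨0, 0, 1, 0⟩
  have h3 := h ⟨0, 0, 0, 1⟩
  simp [ha, hb] at h0 h1 h2 h3
  ext <;> simp [*]

/-- A matrix representation is injective, since it preserves the trace form. -/
theorem rep_injective [CharZero F] [CharZero L] (ha : a ≠ 0) (hb : b ≠ 0)
    (φ : ℍ[F,a,b] →+* Matrix (Fin 2) (Fin 2) L)
    (φ₀ : F →+* L) (h : ∀ c, φ (algebraMap F _ c) = φ₀ c • 1) : Function.Injective φ := by
  rw [injective_iff_map_eq_zero]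
  intro x hx
  apply eq_zero_of_forall_re_mul ha hb
  intro y
  have h1 := trace_map ha hb φ φ₀ h (x * y)
  rw [map_mul, hx, zero_mul, trace_zero, eq_comm, map_eq_zero] at h1
  exact (mul_eq_zero.1 h1).resolve_left two_ne_zero

/-- An eigenvector of a matrix `M` that is not a scalar is an eigenvector of every matrix that
commutes with `M`. -/
theorem exists_eigen_of_commute {M N : Matrix (Fin 2) (Fin 2) L} {v : Fin 2 → L} {μ : L}
    (hv : v ≠ 0) (hM : M *ᵥ v = μ • v) (hns : M ≠ μ • 1) (hMN : M * N = N * M) :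
    ∃ ν : L, N *ᵥ v = ν • v := by
  have hNv : M *ᵥ (N *ᵥ v) = μ • (N *ᵥ v) := by
    rw [mulVec_mulVec, hMN, ← mulVec_mulVec, hM, mulVec_smul]
  -- a nonzero row of `M - μ` annihilates both `v` and `N v`, so these are proportional
  set P := M - μ • (1 : Matrix (Fin 2) (Fin 2) L) with hP
  have hPv : P *ᵥ v = 0 := by rw [hP, sub_mulVec, hM, smul_mulVec, one_mulVec, sub_self]
  have hPw : P *ᵥ (N *ᵥ v) = 0 := by rw [hP, sub_mulVec, hNv, smul_mulVec, one_mulVec, sub_self]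
  have hP0 : P ≠ 0 := sub_ne_zero.2 hns
  set w := N *ᵥ v
  obtain ⟨i, hi⟩ : ∃ i, P i ≠ 0 := by
    by_contra! hc
    exact hP0 (by ext i j; rw [hc i]; rfl)
  have e1 : P i 0 * v 0 + P i 1 * v 1 = 0 := by
    simpa [mulVec, dotProduct, Fin.sum_univ_two] using congrFun hPv i
  have e2 : P i 0 * w 0 + P i 1 * w 1 = 0 := by
    simpa [mulVec, dotProduct, Fin.sum_univ_two] using congrFun hPw i
  have e3 : v 0 * w 1 - v 1 * w 0 = 0 := by
    by_contra hc
    apply hi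
    ext j
    fin_cases j
    · refine (mul_eq_zero.1 (?_ : P i 0 * (v 0 * w 1 - v 1 * w 0) = 0)).resolve_right hc
      linear_combination w 1 * e1 - v 1 * e2
    · refine (mul_eq_zero.1 (?_ : P i 1 * (v 0 * w 1 - v 1 * w 0) = 0)).resolve_right hc
      linear_combination v 0 * e2 - w 0 * e1
  by_cases h0 : v 0 = 0
  · have h1 : v 1 ≠ 0 := fun h1 => hv (by ext j; fin_cases j <;> simp [h0, h1])
    refine ⟨w 1 / v 1, ?_⟩
    ext j; fin_cases j
    · have : w 0 = 0 := by simpa [h0, h1] using e3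
      simp [h0, this]
    · simp [h1]
  · refine ⟨w 0 / v 0, ?_⟩
    ext j; fin_cases j
    · simp [h0]
    · simp only [Fin.mk_one, Pi.smul_apply, smul_eq_mul]
      field_simp
      linear_combination e3

end Representation

/-! ### The fixed points of `ψ(u)` and their stabilizers -/

theorem IsHyperbolic.smul {M N : Matrix (Fin 2) (Fin 2) ℝ} {w w' : OnePoint ℝ} {μ μ' : ℝ}
    (h : IsHyperbolic M w w' μ μ') {g : GL (Fin 2) ℝ}
    (hN : N * (g : Matrix (Fin 2) (Fin 2) ℝ) = g * M) :
    IsHyperbolic N (g • w) (g • w') μ μ' := by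
  have key (x : OnePoint ℝ) (ν : ℝ) (hx : M *ᵥ lineVec x = ν • lineVec x) :
      N *ᵥ lineVec (g • x) = ν • lineVec (g • x) := by
    obtain ⟨k, hk, e⟩ := mulVec_lineVec g x
    have e' : lineVec (g • x) = k⁻¹ • ((g : Matrix (Fin 2) (Fin 2) ℝ) *ᵥ lineVec x) := by
      rw [e, smul_smul, inv_mul_cancel₀ hk, one_smul]
    rw [e', mulVec_smul, mulVec_mulVec, hN, ← mulVec_mulVec, hx, mulVec_smul, smul_comm]
  exact ⟨h.lt, key _ _ h.eigen, key _ _ h.eigen'⟩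

theorem IsHyperbolic.unique {M : Matrix (Fin 2) (Fin 2) ℝ} {w₁ w₁' w₂ w₂' : OnePoint ℝ} {μ μ' : ℝ}
    (h₁ : IsHyperbolic M w₁ w₁' μ μ') (h₂ : IsHyperbolic M w₂ w₂' μ μ') : w₁ = w₂ := by
  obtain ⟨g, -, h0, h1⟩ := exists_frame h₁.ne
  have hc := h₁.conj h0 h1
  have hD : !![μ', 0; 0, μ] * ((g⁻¹ : GL (Fin 2) ℝ) : Matrix (Fin 2) (Fin 2) ℝ) =
      ((g⁻¹ : GL (Fin 2) ℝ) : Matrix (Fin 2) (Fin 2) ℝ) * M := by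
    rw [Units.mul_inv_eq_iff_eq_mul, mul_assoc, hc, ← mul_assoc, Units.inv_mul, one_mul]
  have h3 := congrFun (h₂.smul hD).eigen 0
  have hlt := h₁.lt
  rw [← h0, eq_comm, ← inv_smul_eq_iff]
  generalize g⁻¹ • w₂ = x at h3
  induction x using OnePoint.rec with
  | infty =>
    simp at h3
    exact absurd h3 hlt.ne
  | coe t =>
    have h4 : (μ - μ') * t = 0 := by simp at h3; linarith
    rw [(mul_eq_zero.1 h4).resolve_left (sub_ne_zero.2 hlt.ne')]

namespace Setting

variable {F : Type*} [Field F] [NumberField F] {p : ℕ} [Fact p.Prime] (D : Setting F p)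

theorem iotaInf_algebraMap (c : F) : D.iotaInf (algebraMap F _ c) = D.vInf c • 1 := by
  rw [D.iotaInf_scalar, Algebra.algebraMap_eq_smul_one]

theorem trace_iotaInf (x : D.B) : (D.iotaInf x).trace = D.vInf (2 * x.re) :=
  trace_map D.a_ne D.b_ne D.iotaInf D.vInf D.iotaInf_algebraMap x

theorem det_iotaInf (x : D.B) : (D.iotaInf x).det = D.vInf (nrd x) :=
  det_map D.a_ne D.b_ne D.iotaInf D.vInf D.iotaInf_algebraMap x

theorem iotaInf_injective : Function.Injective D.iotaInf :=
  rep_injective D.a_ne D.b_ne D.iotaInf D.vInf D.iotaInf_algebraMap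

theorem matP_algebraMap (c : F) : D.matP (algebraMap F _ c) =
    (D.emb.comp (algebraMap F (D.prime.adicCompletion F))) c • 1 := by
  ext i j
  rw [matP_apply, AlgHomClass.commutes, algebraMap_matrix_apply]
  by_cases h : i = j
  · simp [h]
  · simp [h]

theorem coe_toGLInf (γ : D.Gamma0) :
    (D.toGLInf γ : Matrix (Fin 2) (Fin 2) ℝ) = D.iotaInf ((γ : (D.B)ˣ) : D.B) := rfl

theorem det_toGLInf (γ : D.Gamma0) : (D.toGLInf γ : Matrix (Fin 2) (Fin 2) ℝ).det = 1 := by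
  rw [coe_toGLInf, det_iotaInf, γ.2.2.2, map_one]

theorem det_toGLInf_pos (γ : D.Gamma0) : 0 < (D.toGLInf γ : Matrix (Fin 2) (Fin 2) ℝ).det := by
  rw [det_toGLInf]; exact one_pos

theorem smul_eq_toGLInf_smul (γ : D.Gamma0) (x : OnePoint ℝ) : γ • x = D.toGLInf γ • x := rfl

end Setting

namespace OptimalEmbedding

variable {F : Type*} [Field F] [NumberField F] {p : ℕ} [Fact p.Prime] {D : Setting F p}
  {K : Type*} [Field K] [NumberField K] [Algebra F K] (E : OptimalEmbedding D K)

/-- A unit of relative norm one in `F` is `±1`, so `u` generates `K` over `F`. -/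
theorem algebraMap_ne_u (c : F) : algebraMap F K c ≠ E.u := by
  intro h
  have h1 := E.u_generator.1.2.2
  rw [← h, Algebra.norm_algebraMap, E.quadratic] at h1
  apply E.u_generator.2.1
  rw [isOfFinOrder_iff_pow_eq_one]
  refine ⟨2, two_pos, ?_⟩
  ext
  rw [Units.val_pow_eq_pow_val, ← h, ← map_pow, h1, map_one, Units.val_one]

theorem isUnit_psi_sub (c : F) : IsUnit (E.psi E.u - algebraMap F _ c) := by
  rw [← AlgHom.commutes E.psi, ← map_sub]
  exact (IsUnit.mk0 _ (sub_ne_zero.2 (E.algebraMap_ne_u c).symm)).map E.psi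

/-- The discriminant of the characteristic polynomial of `γ_ψ`. -/
def disc : ℝ := (E.gammaMat 1 1 - E.gammaMat 0 0) ^ 2 + 4 * E.gammaMat 0 1 * E.gammaMat 1 0

theorem disc_eq : E.disc = D.vInf (2 * (E.psi E.u).re) ^ 2 - 4 * D.vInf (nrd (E.psi E.u)) := by
  rw [← D.trace_iotaInf, ← D.det_iotaInf, trace_fin_two, det_fin_two]
  simp only [disc, gammaMat]
  ring

/-- The place `v_∞` splits in `K`, so that `γ_ψ` has distinct real eigenvalues. -/
theorem disc_pos : 0 < E.disc := by
  obtain ⟨τ, hτ⟩ := (E.real_iff D.vInf).2 rfl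
  have h1 : (E.u : K) ^ 2 - algebraMap F K (2 * (E.psi E.u).re) * E.u +
      algebraMap F K (nrd (E.psi E.u)) = 0 := by
    apply E.psi.toRingHom.injective
    change E.psi _ = E.psi _
    simp only [map_add, map_sub, map_pow, AlgHom.commutes, map_zero]
    rw [map_mul E.psi, AlgHom.commutes, algebraMap_add_star, ← mul_star_eq_nrd, add_mul, sq,
      mul_star_eq_nrd, ← star_mul_eq_nrd]
    abel
  have h2 := congrArg τ h1
  have hτ' (c : F) : τ (algebraMap F K c) = D.vInf c := by rw [← hτ]; rfl
  rw [map_add, map_sub, map_mul, map_pow, hτ', hτ', map_zero] at h2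
  have h3 : E.disc = (2 * τ E.u - D.vInf (2 * (E.psi E.u).re)) ^ 2 := by
    rw [disc_eq]; linear_combination -4 * h2
  rw [h3]
  apply sq_pos_of_ne_zero
  intro h4
  apply E.algebraMap_ne_u (E.psi E.u).re
  apply τ.injective
  rw [hτ']
  rw [map_mul, map_ofNat] at h4
  linarith

theorem sqrtDisc_pos : 0 < E.sqrtDisc := Real.sqrt_pos.2 E.disc_pos

theorem sqrtDisc_sq : E.sqrtDisc ^ 2 = E.disc := Real.sq_sqrt E.disc_pos.le

/-- The eigenvalue of `γ_ψ` at `τ_{ψ,∞}`. -/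
def eig : ℝ := (E.gammaMat 0 0 + E.gammaMat 1 1 + E.sqrtDisc) / 2

/-- The eigenvalue of `γ_ψ` at `τ'_{ψ,∞}`. -/
def eigConj : ℝ := (E.gammaMat 0 0 + E.gammaMat 1 1 - E.sqrtDisc) / 2

theorem isHyperbolic_gammaMat : IsHyperbolic E.gammaMat E.tau E.tauConj E.eig E.eigConj := by
  have hc : E.gammaMat 1 0 ≠ 0 := E.lower_left_ne
  have hs := E.sqrtDisc_sq
  rw [disc] at hs
  refine ⟨?_, ?_, ?_⟩
  · have := E.sqrtDisc_pos
    rw [eig, eigConj]; linarith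
  · ext i; fin_cases i
    · simp [tau, eig]
      field_simp
      linear_combination -hs
    · simp [tau, eig]
      field_simp
      ring
  · ext i; fin_cases i
    · simp [tauConj, eigConj]
      field_simp
      linear_combination -hs
    · simp [tauConj, eigConj]
      field_simp
      ring

/-- Eigenvectors of `γ_ψ` are not killed by nonzero elements `n` of `B`: otherwise
`n γ_ψ = μ' n` for an eigenvalue `μ'` of `γ_ψ`, and comparing reduced traces shows that `μ'` lies
in `F`, so that `n` is killed by the unit `γ_ψ - μ'`. -/
theorem eq_zero_of_mulVec_eq_zero {t μ : ℝ} (ht : E.gammaMat *ᵥ ![t, 1] = μ • ![t, 1]) {n : D.B}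
    (hn : D.iotaInf n *ᵥ ![t, 1] = 0) : n = 0 := by
  by_contra hne
  set μ' := E.gammaMat 0 0 + E.gammaMat 1 1 - μ with hμ'
  have h1 : D.iotaInf n * E.gammaMat = μ' • D.iotaInf n := by
    have e0 := congrFun ht 0
    have e1 := congrFun ht 1
    have n0 := congrFun hn 0
    have n1 := congrFun hn 1
    simp at e0 e1 n0 n1
    have n0' : D.iotaInf n 0 1 = -(D.iotaInf n 0 0 * t) := by linarith
    have n1' : D.iotaInf n 1 1 = -(D.iotaInf n 1 0 * t) := by linarith
    ext i j
    fin_cases i <;> fin_cases j <;>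
      simp only [mul_apply, Fin.sum_univ_two, Matrix.smul_apply, smul_eq_mul, Fin.zero_eta,
        Fin.mk_one, n0', n1', hμ']
    · linear_combination (-D.iotaInf n 0 0) * e1
    · linear_combination (D.iotaInf n 0 0) * e0
    · linear_combination (-D.iotaInf n 1 0) * e1
    · linear_combination (D.iotaInf n 1 0) * e0
  obtain ⟨y, hy⟩ : ∃ y, (n * y).re ≠ 0 := by
    by_contra! hc
    exact hne (eq_zero_of_forall_re_mul D.a_ne D.b_ne hc)
  have h2 : D.vInf (2 * (n * E.psi E.u * y).re) = μ' * D.vInf (2 * (n * y).re) := by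
    rw [← D.trace_iotaInf, ← D.trace_iotaInf, map_mul, map_mul, map_mul]
    change (D.iotaInf n * E.gammaMat * D.iotaInf y).trace = _
    rw [h1, smul_mul_assoc, trace_smul, smul_eq_mul]
  have h3 : μ' = D.vInf ((n * E.psi E.u * y).re / (n * y).re) := by
    have hy' : D.vInf ((n * y).re) ≠ 0 := (map_ne_zero _).2 hy
    rw [map_mul, map_mul, map_ofNat] at h2
    rw [map_div₀, eq_div_iff hy']
    linarith
  apply hne
  rw [← (E.isUnit_psi_sub ((n * E.psi E.u * y).re / (n * y).re)).mul_left_eq_zero]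
  apply D.iotaInf_injective
  rw [map_zero, map_mul, map_sub, D.iotaInf_algebraMap, ← h3, mul_sub, mul_smul_comm, mul_one]
  exact sub_eq_zero.2 h1

/-- The stabilizer of `τ_{ψ,∞}` in `Γ₀` commutes with `ψ(u)`. -/
theorem commute_of_smul_tau_eq {γ : D.Gamma0} (h : γ • E.tau = E.tau) :
    ((γ : (D.B)ˣ) : D.B) * E.psi E.u = E.psi E.u * ((γ : (D.B)ˣ) : D.B) := by
  obtain ⟨k, hk⟩ := (smul_eq_iff (D.toGLInf γ) _ _).1 h
  rw [D.coe_toGLInf] at hk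
  have hu := E.isHyperbolic_gammaMat.eigen
  rw [← sub_eq_zero]
  refine E.eq_zero_of_mulVec_eq_zero hu ?_
  change D.iotaInf _ *ᵥ lineVec E.tau = 0
  rw [map_sub, map_mul, map_mul, sub_mulVec, ← mulVec_mulVec, ← mulVec_mulVec, hk]
  change _ *ᵥ (E.gammaMat *ᵥ _) - E.gammaMat *ᵥ _ = 0
  rw [hu, mulVec_smul, mulVec_smul, hk, hu, smul_comm, sub_self]

theorem smul_tauConj_eq_of_commute {γ : D.Gamma0}
    (h : ((γ : (D.B)ˣ) : D.B) * E.psi E.u = E.psi E.u * ((γ : (D.B)ˣ) : D.B)) :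
    γ • E.tauConj = E.tauConj := by
  rw [D.smul_eq_toGLInf_smul, smul_eq_iff]
  refine exists_eigen_of_commute (M := E.gammaMat) (lineVec_ne_zero _)
    E.isHyperbolic_gammaMat.eigen' ?_ ?_
  · intro hs
    apply E.lower_left_ne
    change E.gammaMat 1 0 = 0
    rw [hs]; simp
  · rw [D.coe_toGLInf, gammaMat, ← map_mul, ← map_mul, h]

/-- A scalar matrix equals its adjugate, so only elements of `F` have scalar matrices. -/
theorem matP_psi_ne_smul_one (μ : ℂ_[p]) : D.matP (E.psi E.u) ≠ μ • 1 := by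
  intro h
  have h1 : D.matP (star (E.psi E.u)) = D.matP (E.psi E.u) := by
    rw [map_star D.a_ne D.b_ne D.matP _ D.matP_algebraMap, h, adjugate_fin_two]
    ext i j
    fin_cases i <;> fin_cases j <;> simp
  have h2 := rep_injective D.a_ne D.b_ne D.matP _ D.matP_algebraMap h1
  apply E.algebraMap_ne_u (E.psi E.u).re
  apply E.psi.toRingHom.injective
  change E.psi _ = E.psi _
  rw [AlgHom.commutes]
  have h3 := congrArg (fun x => QuaternionAlgebra.imI x) h2
  have h4 := congrArg (fun x => QuaternionAlgebra.imJ x) h2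
  have h5 := congrArg (fun x => QuaternionAlgebra.imK x) h2
  simp at h3 h4 h5
  have e (x : F) (hx : -x = x) : x = 0 := neg_eq_self.1 hx
  ext
  · simp
  · simpa using (e _ h3).symm
  · simpa using (e _ h4).symm
  · simpa using (e _ h5).symm

theorem smul_tauP_eq_of_commute {γ : D.Gamma0}
    (h : ((γ : (D.B)ˣ) : D.B) * E.psi E.u = E.psi E.u * ((γ : (D.B)ˣ) : D.B)) :
    γ • E.tauP = E.tauP := by
  obtain ⟨ν, hν⟩ := exists_eigen_of_commute (N := D.matP ((γ : (D.B)ˣ) : D.B))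
    (v := ![(E.tauP : ℂ_[p]), 1]) (by intro h0; simpa using congrFun h0 1)
    (E.tauP_eigen E.u) (E.matP_psi_ne_smul_one _) (by rw [← map_mul, ← map_mul, h])
  have h0 := congrFun hν 0
  have h1 := congrFun hν 1
  simp at h0 h1
  apply Subtype.ext
  have hd := D.denom_ne γ E.tauP.2
  rw [D.coe_smul_A0, div_eq_iff hd, h0, h1, mul_comm]

theorem commute_and_smul_eq_of_smul_tau_eq {γ₁ γ₂ : D.Gamma0} (h : γ₁ • E.tau = γ₂ • E.tau) :
    ((γ₂⁻¹ * γ₁ : D.Gamma0) : (D.B)ˣ) * E.psi E.u =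
      E.psi E.u * (((γ₂⁻¹ * γ₁ : D.Gamma0) : (D.B)ˣ) : D.B) ∧
    γ₁ • E.tauConj = γ₂ • E.tauConj ∧ γ₁ • E.tauP = γ₂ • E.tauP := by
  have h1 : (γ₂⁻¹ * γ₁) • E.tau = E.tau := by rw [mul_smul, h, inv_smul_smul]
  have h2 := E.commute_of_smul_tau_eq h1
  refine ⟨h2, ?_, ?_⟩
  · rw [← inv_smul_eq_iff, ← mul_smul]
    exact E.smul_tauConj_eq_of_commute h2
  · rw [← inv_smul_eq_iff, ← mul_smul]
    exact E.smul_tauP_eq_of_commute h2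

/-- The conjugate `γ_w ψ(u) γ_w⁻¹` of `ψ(u)`, which fixes `w` and `w'`. -/
def beta (w : E.Orbit) : D.B :=
  ((E.rep w : (D.B)ˣ) : D.B) * E.psi E.u * (((E.rep w)⁻¹ : D.Gamma0) : (D.B)ˣ)

/-- The real matrix of `γ_w ψ(u) γ_w⁻¹`. -/
def betaMat (w : E.Orbit) : Matrix (Fin 2) (Fin 2) ℝ := D.iotaInf (E.beta w)

theorem beta_mul_rep (w : E.Orbit) :
    E.beta w * ((E.rep w : (D.B)ˣ) : D.B) = ((E.rep w : (D.B)ˣ) : D.B) * E.psi E.u := by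
  rw [beta, mul_assoc, Subgroup.coe_inv, Units.inv_mul, mul_one]

theorem beta_mem (w : E.Orbit) : E.beta w ∈ D.R :=
  D.R.mul_mem (D.R.mul_mem (E.rep w).2.1 ((E.optimal _).2 E.u_generator.1.1)) (E.rep w)⁻¹.2.1

theorem nrd_beta (w : E.Orbit) : nrd (E.beta w) = nrd (E.psi E.u) := by
  rw [beta, nrd_mul, nrd_mul, (E.rep w).2.2.2, (E.rep w)⁻¹.2.2.2, one_mul, mul_one]

theorem isHyperbolic_betaMat (w : E.Orbit) :
    IsHyperbolic (E.betaMat w) w (E.conj w) E.eig E.eigConj := by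
  have h := E.isHyperbolic_gammaMat.smul (N := E.betaMat w) (g := D.toGLInf (E.rep w)) (by
    rw [D.coe_toGLInf, betaMat, gammaMat, ← map_mul, ← map_mul, beta_mul_rep])
  have h1 : D.toGLInf (E.rep w) • E.tau = w := E.rep_smul w
  rw [h1] at h
  exact h

/-- The choice of `γ_w` does not affect the conjugate, since the stabilizer of `τ_{ψ,∞}` commutes
with `ψ(u)`; so the conjugates are permuted by `Γ₀`. -/
theorem beta_smul (γ : D.Gamma0) (w : E.Orbit) :
    E.beta (γ • w) * ((γ : (D.B)ˣ) : D.B) = ((γ : (D.B)ˣ) : D.B) * E.beta w := by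
  have h : E.rep (γ • w) • E.tau = (γ * E.rep w) • E.tau := by
    rw [mul_smul, rep_smul, rep_smul]; rfl
  have h1 := (E.commute_and_smul_eq_of_smul_tau_eq h).1
  simp only [_root_.mul_inv_rev, Subgroup.coe_mul, Subgroup.coe_inv, Units.val_mul] at h1
  simp only [beta, Subgroup.coe_inv]
  set r' : (D.B)ˣ := (E.rep (γ • w)).1
  set r : (D.B)ˣ := (E.rep w).1
  set g : (D.B)ˣ := γ.1
  set x := E.psi E.u
  have h2 : (r' : D.B) * x =
      g * r * (x * (((r⁻¹ : (D.B)ˣ) : D.B) * ((g⁻¹ : (D.B)ˣ) : D.B) * r')) := by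
    rw [← h1]
    simp only [← mul_assoc]
    rw [mul_assoc (g : D.B) r, Units.mul_inv, mul_one, Units.mul_inv, one_mul]
  rw [h2]
  simp only [mul_assoc]
  rw [Units.mul_inv_cancel_left, Units.inv_mul, mul_one]

theorem betaMat_smul (γ : D.Gamma0) (w : E.Orbit) :
    E.betaMat (γ • w) * (D.toGLInf γ : Matrix (Fin 2) (Fin 2) ℝ) =
      (D.toGLInf γ : Matrix (Fin 2) (Fin 2) ℝ) * E.betaMat w := by
  rw [D.coe_toGLInf, betaMat, betaMat, ← map_mul, ← map_mul, beta_smul]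

theorem pt_smul (γ : D.Gamma0) (w : E.Orbit) : E.pt (γ • w) = γ • E.pt w := by
  have h : E.rep (γ • w) • E.tau = (γ * E.rep w) • E.tau := by
    rw [mul_smul, rep_smul, rep_smul]; rfl
  rw [pt, pt, (E.commute_and_smul_eq_of_smul_tau_eq h).2.2, mul_smul]

/-- `w` is recovered from `γ_w ψ(u) γ_w⁻¹` as the fixed point with the larger eigenvalue. -/
theorem betaMat_injective : Function.Injective E.betaMat := by
  intro w₁ w₂ h
  have h2 := E.isHyperbolic_betaMat w₂
  rw [← h] at h2
  exact Subtype.ext ((E.isHyperbolic_betaMat w₁).unique h2)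

end OptimalEmbedding

/-! ### Finiteness of bounded subsets of an order -/

/-- The values of a linear form on a finitely generated submodule have a common denominator. -/
theorem exists_common_denominator {A k V : Type*} [CommRing A] [IsDomain A] [Field k] [Algebra A k]
    [IsFractionRing A k] [AddCommGroup V] [Module A V] {N : Submodule A V} (hN : N.FG)
    (f : V →ₗ[A] k) :
    ∃ d : A, d ≠ 0 ∧ ∀ x ∈ N, ∃ m : A, algebraMap A k d * f x = algebraMap A k m := by
  classical
  obtain ⟨S, rfl⟩ := hN
  obtain ⟨d, hd⟩ := IsLocalization.exist_integer_multiples_of_finset (nonZeroDivisors A) (S.image f)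
  refine ⟨d, nonZeroDivisors.ne_zero d.2, fun x hx => ?_⟩
  induction hx using Submodule.span_induction with
  | mem x hx =>
    obtain ⟨m, hm⟩ := hd (f x) (Finset.mem_image_of_mem f hx)
    exact ⟨m, by rw [hm, Algebra.smul_def]⟩
  | zero => exact ⟨0, by simp⟩
  | add x y _ _ hx hy =>
    obtain ⟨m, hm⟩ := hx
    obtain ⟨n, hn⟩ := hy
    exact ⟨m + n, by rw [map_add, mul_add, hm, hn, map_add]⟩
  | smul c x _ hx =>
    obtain ⟨m, hm⟩ := hx
    exact ⟨c * m, by rw [map_smul, Algebra.smul_def, mul_left_comm, hm, map_mul]⟩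

/-- In a totally real field there are finitely many elements with a given denominator and with
bounded conjugates. -/
theorem finite_of_abs_le {F : Type*} [Field F] [NumberField F] (hF : NumberField.IsTotallyReal F)
    {d : 𝓞 F} (hd : d ≠ 0) (C : (F →+* ℝ) → ℝ) :
    {c : F | (∃ m : 𝓞 F, (d : F) * c = m) ∧ ∀ σ : F →+* ℝ, |σ c| ≤ C σ}.Finite := by
  have hd' : (d : F) ≠ 0 := by exact_mod_cast hd
  have hr (φ : F →+* ℂ) : ∃ σ : F →+* ℝ, ∀ x, φ x = σ x :=
    ⟨_, fun x => (NumberField.ComplexEmbedding.IsReal.coe_embedding_apply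
      (NumberField.IsTotallyReal.complexEmbedding_isReal φ) x).symm⟩
  choose r hr using hr
  obtain ⟨B, hB⟩ := (Set.finite_range fun φ : F →+* ℂ => |r φ d| * C (r φ)).bddAbove
  refine Set.Finite.of_finite_image
    ((NumberField.Embeddings.finite_of_norm_le F ℂ B).subset ?_)
    (mul_right_injective₀ hd').injOn (f := fun c => (d : F) * c)
  rintro _ ⟨c, ⟨⟨m, hm⟩, hc⟩, rfl⟩
  refine ⟨by simp only [hm]; exact m.isIntegral_coe, fun φ => ?_⟩
  refine le_trans ?_ (hB ⟨φ, rfl⟩)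
  rw [hr, Complex.norm_real, Real.norm_eq_abs, map_mul, abs_mul]
  exact mul_le_mul_of_nonneg_left (hc _) (abs_nonneg _)

/-- A real quaternion algebra `(α, β)` with `α > 0` or `β > 0` splits. -/
theorem nonempty_algEquiv_of_pos {α β : ℝ} (hα : α ≠ 0) (hβ : β ≠ 0) (h : 0 < α ∨ 0 < β) :
    Nonempty (ℍ[ℝ,α,β] ≃ₐ[ℝ] Matrix (Fin 2) (Fin 2) ℝ) := by
  suffices ∃ I J : Matrix (Fin 2) (Fin 2) ℝ, I * I = α • 1 ∧ J * J = β • 1 ∧ J * I = -(I * J) by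
    obtain ⟨I, J, h1, h2, h3⟩ := this
    let q : QuaternionAlgebra.Basis (Matrix (Fin 2) (Fin 2) ℝ) α 0 β :=
      { i := I
        j := J
        k := I * J
        i_mul_i := by rw [h1, zero_smul, add_zero]
        j_mul_j := h2
        i_mul_j := rfl
        j_mul_i := by rw [h3, zero_smul, zero_sub] }
    have hinj : Function.Injective q.liftHom :=
      rep_injective hα hβ q.liftHom.toRingHom (RingHom.id ℝ) fun c => by
        change q.liftHom _ = _
        rw [AlgHom.commutes, Algebra.algebraMap_eq_smul_one]
        rfl
    have hsurj : Function.Surjective q.liftHom :=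
      (LinearMap.injective_iff_surjective_of_finrank_eq_finrank (f := q.liftHom.toLinearMap) (by
        rw [QuaternionAlgebra.finrank_eq_four, Module.finrank_matrix]; simp)).1 hinj
    exact ⟨AlgEquiv.ofBijective q.liftHom ⟨hinj, hsurj⟩⟩
  rcases h with h | h
  · refine ⟨!![√α, 0; 0, -√α], !![0, β; 1, 0], ?_, ?_, ?_⟩ <;>
      ext i j <;> fin_cases i <;> fin_cases j <;> simp [Real.mul_self_sqrt h.le, mul_comm]
  · refine ⟨!![0, α; 1, 0], !![√β, 0; 0, -√β], ?_, ?_, ?_⟩ <;>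
      ext i j <;> fin_cases i <;> fin_cases j <;> simp [Real.mul_self_sqrt h.le, mul_comm]

namespace Setting

variable {F : Type*} [Field F] [NumberField F] {p : ℕ} [Fact p.Prime] (D : Setting F p)

theorem map_neg_of_ne {σ : F →+* ℝ} (h : σ ≠ D.vInf) : σ D.a < 0 ∧ σ D.b < 0 := by
  have ha : σ D.a ≠ 0 := (map_ne_zero σ).2 D.a_ne
  have hb : σ D.b ≠ 0 := (map_ne_zero σ).2 D.b_ne
  by_contra hc
  apply h
  rw [← D.split_iff]
  apply nonempty_algEquiv_of_pos ha hb
  rcases not_and_or.1 hc with h1 | h1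
  · exact Or.inl (lt_of_le_of_ne (not_lt.1 h1) ha.symm)
  · exact Or.inr (lt_of_le_of_ne (not_lt.1 h1) hb.symm)

/-- Elements of `R` of given reduced norm with bounded image in `M₂(ℝ)` have bounded coordinates:
at `v_∞` because the coordinates are traces, at the other places because there the reduced norm is
positive definite. So there are only finitely many of them. -/
theorem finite_of_nrd_eq (n : F) (C : ℝ) :
    {x : D.B | x ∈ D.R ∧ nrd x = n ∧ ∀ i j, |D.iotaInf x i j| ≤ C}.Finite := by
  let e : Fin 4 → D.B := ![1, ⟨0, 1, 0, 0⟩, ⟨0, 0, 1, 0⟩, ⟨0, 0, 0, 1⟩]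
  let f (m : Fin 4) : D.B →ₗ[𝓞 F] F :=
    { toFun := fun x => (x * e m).re
      map_add' := fun x y => by rw [add_mul, QuaternionAlgebra.re_add]
      map_smul' := fun c x => by
        simp only [QuaternionAlgebra.re_mul, QuaternionAlgebra.re_smul,
          QuaternionAlgebra.imI_smul, QuaternionAlgebra.imJ_smul, QuaternionAlgebra.imK_smul,
          Algebra.smul_def, RingHom.id_apply]
        ring }
  have hfg : (Subalgebra.toSubmodule D.R).FG := D.isMaximalOrder.1.1
  choose d hd hdf using fun m => exists_common_denominator (k := F) hfg (f m)
  have hbound (m : Fin 4) (σ : F →+* ℝ) : ∃ C' : ℝ, ∀ x : D.B, nrd x = n →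
      (∀ i j, |D.iotaInf x i j| ≤ C) → |σ (x * e m).re| ≤ C' := by
    by_cases hσ : σ = D.vInf
    · subst hσ
      refine ⟨∑ i, ∑ j, C * |D.iotaInf (e m) j i|, fun x _ hx => ?_⟩
      have h1 := D.trace_iotaInf (x * e m)
      have h2 : |D.vInf (2 * (x * e m).re)| ≤ ∑ i, ∑ j, C * |D.iotaInf (e m) j i| := by
        rw [← h1, map_mul, trace]
        refine (Finset.abs_sum_le_sum_abs _ _).trans (Finset.sum_le_sum fun i _ => ?_)
        rw [diag_apply, mul_apply]
        refine (Finset.abs_sum_le_sum_abs _ _).trans (Finset.sum_le_sum fun j _ => ?_)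
        rw [abs_mul]
        exact mul_le_mul_of_nonneg_right (hx i j) (abs_nonneg _)
      refine le_trans ?_ h2
      rw [map_mul, map_ofNat, abs_mul, abs_two]
      linarith [abs_nonneg (D.vInf (x * e m).re)]
    · obtain ⟨ha, hb⟩ := D.map_neg_of_ne hσ
      refine ⟨(1 - σ D.a - σ D.b + σ D.a * σ D.b) * σ n + 1, fun x hx _ => ?_⟩
      have hab : 0 < σ D.a * σ D.b := mul_pos_of_neg_of_neg ha hb
      have hn := congrArg σ hx
      rw [nrd_eq] at hn
      simp only [map_add, map_sub, map_mul, map_pow] at hn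
      have h0 := sq_nonneg (σ x.re)
      have h1 := mul_nonneg (neg_nonneg.2 ha.le) (sq_nonneg (σ x.imI))
      have h2 := mul_nonneg (neg_nonneg.2 hb.le) (sq_nonneg (σ x.imJ))
      have h3 := mul_nonneg hab.le (sq_nonneg (σ x.imK))
      have hn0 : 0 ≤ σ n := by linarith
      have hsq : (σ (x * e m).re) ^ 2 ≤ (1 - σ D.a - σ D.b + σ D.a * σ D.b) * σ n := by
        have k1 := mul_nonneg (neg_nonneg.2 ha.le) hn0
        have k2 := mul_nonneg (neg_nonneg.2 hb.le) hn0
        have k3 := mul_nonneg hab.le hn0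
        fin_cases m
        · simp [e]
          linarith
        · have := mul_le_mul_of_nonneg_left (show -σ D.a * σ x.imI ^ 2 ≤ σ n by linarith)
            (neg_nonneg.2 ha.le)
          simp [e]
          linarith
        · have := mul_le_mul_of_nonneg_left (show -σ D.b * σ x.imJ ^ 2 ≤ σ n by linarith)
            (neg_nonneg.2 hb.le)
          simp [e]
          linarith
        · have := mul_le_mul_of_nonneg_left (show σ D.a * σ D.b * σ x.imK ^ 2 ≤ σ n by linarith)
            hab.le
          simp [e]
          linarith
      have := sq_abs (σ (x * e m).re)
      nlinarith [sq_nonneg (|σ (x * e m).re| - 1), abs_nonneg (σ (x * e m).re)]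
  choose C' hC' using hbound
  have hfin := Set.Finite.pi' fun m => finite_of_abs_le D.totallyReal (hd m) (C' m)
  refine Set.Finite.of_finite_image (f := fun x : D.B => fun m => (x * e m).re)
    (hfin.subset ?_) ?_
  · rintro _ ⟨x, ⟨hxR, hxn, hx⟩, rfl⟩ m
    exact ⟨hdf m x hxR, fun σ => hC' m σ x hxn hx⟩
  · intro x _ y _ hxy
    have h0 := congrFun hxy 0
    have h1 := congrFun hxy 1
    have h2 := congrFun hxy 2
    have h3 := congrFun hxy 3
    simp [e, D.a_ne, D.b_ne] at h0 h1 h2 h3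
    ext <;> assumption

end Setting

/-! ### Cusps -/

namespace OptimalEmbedding

variable {F : Type*} [Field F] [NumberField F] {p : ℕ} [Fact p.Prime] {D : Setting F p}
  {K : Type*} [Field K] [NumberField K] [Algebra F K] (E : OptimalEmbedding D K)

/-- A boundary point is separated from the geodesics `C(w, w')` if the forms of the matrices of
`γ_w ψ(u) γ_w⁻¹` are bounded away from zero at this point. No condition on interior points. -/
def IsSeparated (x : HBar) : Prop :=
  (∃ z : UpperHalfPlane, x = Sum.inl z) ∨ ∃ ε : ℝ, 0 < ε ∧ ∀ w, ε ≤ |formQ (E.betaMat w) x|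

/-- If `B ≅ M₂(ℚ)`, the elements `γ_w ψ(u) γ_w⁻¹` have no rational eigenvector, since subtracting a
rational number from them gives units. -/
theorem mulVec_ne_smul (e : D.B ≃+* Matrix (Fin 2) (Fin 2) ℚ) (w : E.Orbit) {v : Fin 2 → ℚ}
    (hv : v ≠ 0) (μ : ℚ) : e (E.beta w) *ᵥ v ≠ μ • v := by
  intro h
  set c : F := algebraMap ℚ F μ
  have hc : e (algebraMap F _ c) = μ • 1 := by
    have h1 : (e : D.B →+* Matrix (Fin 2) (Fin 2) ℚ).comp
        ((algebraMap F D.B).comp (algebraMap ℚ F)) = algebraMap ℚ _ := Subsingleton.elim _ _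
    have h2 := congrArg (fun f : ℚ →+* Matrix (Fin 2) (Fin 2) ℚ => f μ) h1
    rw [← Algebra.algebraMap_eq_smul_one]
    exact h2
  have h1 : E.beta w - algebraMap F _ c = ((E.rep w : (D.B)ˣ) : D.B) *
      (E.psi E.u - algebraMap F _ c) * (((E.rep w)⁻¹ : D.Gamma0) : (D.B)ˣ) := by
    rw [mul_sub, sub_mul, ← Algebra.commutes, mul_assoc (algebraMap F D.B c), Subgroup.coe_inv,
      Units.mul_inv, mul_one, beta, Subgroup.coe_inv]
  have h2 : IsUnit (E.beta w - algebraMap F D.B c) := by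
    rw [h1]
    exact ((Units.isUnit _).mul (E.isUnit_psi_sub c)).mul (Units.isUnit _)
  obtain ⟨m, hm⟩ := h2.map e
  have h3 : (m : Matrix (Fin 2) (Fin 2) ℚ) *ᵥ v = 0 := by
    rw [hm, map_sub, hc, sub_mulVec, h, smul_mulVec, one_mulVec, sub_self]
  apply hv
  rw [← one_mulVec v, ← Units.inv_mul m, ← mulVec_mulVec, h3, mulVec_zero]

/-- At a cusp the forms of the elements of `R` take values in a lattice in `ℝ`. -/
theorem isSeparated_of_mem_HStar {x : HBar} (hx : x ∈ D.HStar) : E.IsSeparated x := by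
  rcases hx with ⟨z, rfl⟩ | ⟨e, g, q, heg, rfl⟩
  · exact Or.inl ⟨z, rfl⟩
  right
  -- the form of a rational matrix at the rational point `q`
  let f : D.B →+ ℚ :=
    { toFun := fun y => e y 1 0 * lineVec q 0 ^ 2 +
        (e y 1 1 - e y 0 0) * (lineVec q 0 * lineVec q 1) - e y 0 1 * lineVec q 1 ^ 2
      map_zero' := by simp
      map_add' := fun y z => by simp only [map_add, Matrix.add_apply]; ring }
  have : Module.Finite (𝓞 F) D.R := Module.Finite.iff_fg.2 D.isMaximalOrder.1.1
  have : Module.Finite ℤ D.R := Module.Finite.trans (𝓞 F) D.R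
  obtain ⟨d, hd, hdf⟩ := exists_common_denominator (A := ℤ) (k := ℚ) this.fg_top
    (f.comp D.R.toSubring.subtype.toAddMonoidHom).toIntLinearMap
  obtain ⟨k, hk, hf⟩ := formQ_smul_inr g (OnePoint.map (algebraMap ℚ ℝ) q)
  have hval (y : D.B) : formQ (D.iotaInf y) (Sum.inr (g • OnePoint.map (algebraMap ℚ ℝ) q)) =
      k * (f y : ℝ) := by
    rw [hf ((e y).map (algebraMap ℚ ℝ)) (D.iotaInf y)
      (by rw [heg, mul_assoc, Units.inv_mul, mul_one]), formQ_inr]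
    simp only [lineVec_map, Matrix.map_apply, eq_ratCast, f, AddMonoidHom.coe_mk, ZeroHom.coe_mk]
    push_cast
    ring
  have hd' : (0 : ℝ) < |(d : ℝ)| := abs_pos.2 (by exact_mod_cast hd)
  have hk' : 0 < |k| := abs_pos.2 hk
  refine ⟨|k| / |(d : ℝ)|, div_pos hk' hd', fun w => ?_⟩
  have hne : f (E.beta w) ≠ 0 := by
    intro h0
    obtain ⟨μ, hμ⟩ := exists_eigen_of_form_eq_zero _ _ h0
    exact E.mulVec_ne_smul e w (lineVec_ne_zero q) μ hμ
  obtain ⟨m, hm⟩ := hdf ⟨E.beta w, E.beta_mem w⟩ trivial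
  have hm' : (d : ℚ) * f (E.beta w) = m := hm
  have hm0 : m ≠ 0 := by
    rintro rfl
    have : (d : ℚ) ≠ 0 := by exact_mod_cast hd
    rw [Int.cast_zero, mul_eq_zero] at hm'
    exact hne (hm'.resolve_left this)
  have h1 : (1 : ℝ) ≤ |(m : ℝ)| := by exact_mod_cast Int.one_le_abs hm0
  have h2 : ((d : ℝ)) * (f (E.beta w) : ℝ) = m := by exact_mod_cast hm'
  rw [betaMat, hval, abs_mul, div_le_iff₀ hd', mul_assoc, mul_comm |(f (E.beta w) : ℝ)|, ← abs_mul,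
    h2]
  exact le_mul_of_one_le_right hk'.le h1

end OptimalEmbedding

/-! ### Finitely many geodesics meet a segment -/

/-- For a real matrix `(a, b; c, d)` of fixed trace and discriminant, a bound for `a` and `d`
follows from `bc ≥ 0`. For each of `b` and `c` it is enough that it is bounded or that the absolute
value of the other one is bounded from below. -/
theorem abs_le_of_mul_nonneg {M : Matrix (Fin 2) (Fin 2) ℝ} {Δ T k ε : ℝ} (hε : 0 < ε)
    (hΔ : (M 1 1 - M 0 0) ^ 2 + 4 * M 0 1 * M 1 0 = Δ) (hT : M.trace = T)
    (h : 0 ≤ M 0 1 * M 1 0) (h01 : M 0 1 ^ 2 ≤ k ∨ ε ≤ |M 1 0|)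
    (h10 : M 1 0 ^ 2 ≤ k ∨ ε ≤ |M 0 1|) (i j : Fin 2) :
    |M i j| ≤ |T| + Δ + 1 + |k| + Δ / ε := by
  rw [trace_fin_two] at hT
  have hΔ0 : 0 ≤ Δ := by nlinarith [sq_nonneg (M 1 1 - M 0 0)]
  have hd := div_nonneg hΔ0 hε.le
  have hk := abs_nonneg k
  have hk' := le_abs_self k
  have hT' := abs_nonneg T
  have hbc : M 0 1 * M 1 0 ≤ Δ := by nlinarith [sq_nonneg (M 1 1 - M 0 0)]
  have hsq (x : ℝ) : |x| ≤ x ^ 2 + 1 := by nlinarith [sq_abs x, sq_nonneg (|x| - 1), abs_nonneg x]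
  have hoff (x y : ℝ) (hxy : 0 ≤ x * y) (hxyΔ : x * y ≤ Δ) (hx : x ^ 2 ≤ k ∨ ε ≤ |y|) :
      |x| ≤ |T| + Δ + 1 + |k| + Δ / ε := by
    rcases hx with hx | hx
    · linarith [hsq x]
    · have : |x| ≤ Δ / ε := by
        rw [le_div_iff₀ hε]
        calc |x| * ε ≤ |x| * |y| := by gcongr
          _ = x * y := by rw [← abs_mul, abs_of_nonneg hxy]
          _ ≤ Δ := hxyΔ
      linarith
  have hdiff : |M 1 1 - M 0 0| ≤ Δ + 1 := by
    have := hsq (M 1 1 - M 0 0)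
    nlinarith
  have h1 := abs_le.1 hdiff
  have h2 := neg_abs_le T
  have h3 := le_abs_self T
  fin_cases i <;> fin_cases j
  · exact abs_le.2 ⟨by simp only [Fin.zero_eta]; linarith, by simp only [Fin.zero_eta]; linarith⟩
  · exact hoff _ _ h hbc h01
  · exact hoff _ _ (by rwa [mul_comm]) (by rwa [mul_comm]) h10
  · exact abs_le.2 ⟨by simp only [Fin.mk_one]; linarith, by simp only [Fin.mk_one]; linarith⟩

/-- Matrices of fixed trace and discriminant whose geodesic meets a given segment of the imaginary
axis are bounded, provided that their forms stay away from zero at those ends of the segment that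
are `0` or `∞`. -/
theorem exists_abs_le_of_axis {s t : ℝ≥0∞} (hst : s ≤ t) (Δ T : ℝ) {ε : ℝ} (hε : 0 < ε) :
    ∃ C : ℝ, ∀ M : Matrix (Fin 2) (Fin 2) ℝ,
      (M 1 1 - M 0 0) ^ 2 + 4 * M 0 1 * M 1 0 = Δ → M.trace = T →
      formQ M (imAxis s) * formQ M (imAxis t) ≤ 0 →
      (s = 0 ∨ s = ⊤ → ε ≤ |formQ M (imAxis s)|) →
      (t = 0 ∨ t = ⊤ → ε ≤ |formQ M (imAxis t)|) → ∀ i j, |M i j| ≤ C := by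
  suffices ∃ k : ℝ, ∀ M : Matrix (Fin 2) (Fin 2) ℝ,
      (M 1 1 - M 0 0) ^ 2 + 4 * M 0 1 * M 1 0 = Δ →
      formQ M (imAxis s) * formQ M (imAxis t) ≤ 0 →
      (s = 0 ∨ s = ⊤ → ε ≤ |formQ M (imAxis s)|) →
      (t = 0 ∨ t = ⊤ → ε ≤ |formQ M (imAxis t)|) →
      0 ≤ M 0 1 * M 1 0 ∧ (M 0 1 ^ 2 ≤ k ∨ ε ≤ |M 1 0|) ∧ (M 1 0 ^ 2 ≤ k ∨ ε ≤ |M 0 1|) by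
    obtain ⟨k, hk⟩ := this
    refine ⟨|T| + Δ + 1 + |k| + Δ / ε, fun M hΔ hT h hs ht => ?_⟩
    obtain ⟨h1, h2, h3⟩ := hk M hΔ h hs ht
    exact abs_le_of_mul_nonneg hε hΔ hT h1 h2 h3
  simp only [formQ_imAxis]
  rcases eq_or_ne s ⊤ with rfl | hs
  · obtain rfl : t = ⊤ := top_le_iff.1 hst
    refine ⟨0, fun M _ h h1 _ => ?_⟩
    simp [axisCoord] at h h1
    have : M 1 0 = 0 := by nlinarith [mul_self_nonneg (M 1 0)]
    rw [this, abs_zero] at h1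
    linarith
  have hS : 0 ≤ s.toReal := ENNReal.toReal_nonneg
  rcases eq_or_ne t ⊤ with rfl | ht
  · refine ⟨Δ / s.toReal ^ 2, fun M hΔ h h1 h2 => ?_⟩
    simp only [axisCoord, hs, if_false, if_true, mul_one, mul_zero, sub_zero, or_true,
      true_imp_iff, or_false] at h h1 h2
    have hbc : M 1 0 ^ 2 * s.toReal ^ 2 ≤ M 0 1 * M 1 0 := by linarith
    refine ⟨le_trans (by positivity) hbc, Or.inr h2, ?_⟩
    rcases eq_or_ne s 0 with rfl | h0
    · right
      simpa using h1
    · left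
      have hS' : 0 < s.toReal := ENNReal.toReal_pos h0 hs
      rw [le_div_iff₀ (by positivity)]
      nlinarith [sq_nonneg (M 1 1 - M 0 0), mul_nonneg (sq_nonneg (M 1 0)) (sq_nonneg s.toReal)]
  · have hT : 0 ≤ t.toReal := ENNReal.toReal_nonneg
    have hST : s.toReal ≤ t.toReal := (ENNReal.toReal_le_toReal hs ht).2 hst
    refine ⟨Δ * (s.toReal ^ 2 + t.toReal ^ 2) +
      Δ * (s.toReal ^ 2 + t.toReal ^ 2) / (s.toReal ^ 2 * t.toReal ^ 2), fun M hΔ h h1 h2 => ?_⟩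
    simp only [axisCoord, hs, ht, if_false, mul_one, or_false] at h h1 h2
    have ht0 : t ≠ 0 := by
      rintro rfl
      obtain rfl : s = 0 := le_zero_iff.1 hst
      simp at h h1
      have : M 0 1 = 0 := by nlinarith [mul_self_nonneg (M 0 1)]
      rw [this, abs_zero] at h1
      linarith
    have hT' : 0 < t.toReal := ENNReal.toReal_pos ht0 ht
    have hpos : 0 < s.toReal ^ 2 + t.toReal ^ 2 := by positivity
    have hexp : M 1 0 ^ 2 * (s.toReal ^ 2 * t.toReal ^ 2) + M 0 1 ^ 2 ≤
        (M 0 1 * M 1 0) * (s.toReal ^ 2 + t.toReal ^ 2) := by linarith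
    have hbc : 0 ≤ M 0 1 * M 1 0 :=
      nonneg_of_mul_nonneg_left (le_trans (by positivity) hexp) hpos
    have hbcΔ : M 0 1 * M 1 0 ≤ Δ := by nlinarith [sq_nonneg (M 1 1 - M 0 0)]
    have hΔ0 : 0 ≤ Δ := hbc.trans hbcΔ
    have hle := mul_le_mul_of_nonneg_right hbcΔ hpos.le
    refine ⟨hbc, Or.inl ?_, ?_⟩
    · have : 0 ≤ Δ * (s.toReal ^ 2 + t.toReal ^ 2) / (s.toReal ^ 2 * t.toReal ^ 2) := by positivity
      have : 0 ≤ M 1 0 ^ 2 * (s.toReal ^ 2 * t.toReal ^ 2) := by positivity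
      linarith
    · rcases eq_or_ne s 0 with rfl | h0
      · right
        simpa using h1
      · left
        have hS' : 0 < s.toReal := ENNReal.toReal_pos h0 hs
        have : M 1 0 ^ 2 ≤ Δ * (s.toReal ^ 2 + t.toReal ^ 2) / (s.toReal ^ 2 * t.toReal ^ 2) := by
          rw [le_div_iff₀ (by positivity)]
          nlinarith [sq_nonneg (M 0 1)]
        have : 0 ≤ Δ * (s.toReal ^ 2 + t.toReal ^ 2) := by positivity
        linarith

theorem abs_mul_apply_le {M N : Matrix (Fin 2) (Fin 2) ℝ} {C C' : ℝ} (hM : ∀ i j, |M i j| ≤ C)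
    (hN : ∀ i j, |N i j| ≤ C') (i j : Fin 2) : |(M * N) i j| ≤ C * C' + C * C' := by
  have h (k : Fin 2) : |M i k * N k j| ≤ C * C' := by
    rw [abs_mul]
    exact mul_le_mul (hM _ _) (hN _ _) (abs_nonneg _) ((abs_nonneg _).trans (hM i k))
  rw [mul_apply, Fin.sum_univ_two]
  exact (abs_add_le _ _).trans (add_le_add (h 0) (h 1))

theorem exists_forall_abs_apply_le (M : Matrix (Fin 2) (Fin 2) ℝ) : ∃ C, ∀ i j, |M i j| ≤ C := by
  obtain ⟨C, hC⟩ := (Set.finite_range fun x : Fin 2 × Fin 2 => |M x.1 x.2|).bddAbove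
  exact ⟨C, fun i j => hC ⟨(i, j), rfl⟩⟩

namespace OptimalEmbedding

variable {F : Type*} [Field F] [NumberField F] {p : ℕ} [Fact p.Prime] {D : Setting F p}
  {K : Type*} [Field K] [NumberField K] [Algebra F K] (E : OptimalEmbedding D K)

theorem IsSeparated.exists_le {E : OptimalEmbedding D K} {g : GL (Fin 2) ℝ}
    (hg : 0 < (g : Matrix (Fin 2) (Fin 2) ℝ).det) {s : ℝ≥0∞} (hs : E.IsSeparated (g • imAxis s)) :
    ∃ ε : ℝ, 0 < ε ∧ ∀ (w : E.Orbit) (N : Matrix (Fin 2) (Fin 2) ℝ), E.betaMat w * g = g * N →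
      s = 0 ∨ s = ⊤ → ε ≤ |formQ N (imAxis s)| := by
  obtain ⟨k, hk, hf⟩ := formQ_smul hg (imAxis s)
  rcases hs with ⟨z, hz⟩ | ⟨ε, hε, h⟩
  · refine ⟨1, one_pos, fun _ _ _ h0 => ?_⟩
    exfalso
    rcases h0 with rfl | rfl
    · rw [imAxis_zero, Sum.smul_inr] at hz
      cases hz
    · rw [imAxis_top, Sum.smul_inr] at hz
      cases hz
  · refine ⟨ε / k, div_pos hε hk, fun w N hN _ => ?_⟩
    have h1 := h w
    rw [hf _ _ hN, abs_mul, abs_of_pos hk] at h1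
    rwa [div_le_iff₀' hk]

/-- Only finitely many of the geodesics `C(w, w')` separate two given points. -/
theorem finite_formQ_mul_nonpos {x y : HBar} (hx : E.IsSeparated x) (hy : E.IsSeparated y) :
    {w : E.Orbit | formQ (E.betaMat w) x * formQ (E.betaMat w) y ≤ 0}.Finite := by
  obtain ⟨g, hg, s, t, hst, rfl, rfl⟩ := exists_segment x y
  obtain ⟨ε₁, hε₁, h₁⟩ := hx.exists_le hg
  obtain ⟨ε₂, hε₂, h₂⟩ := hy.exists_le hg
  obtain ⟨k₁, hk₁, f₁⟩ := formQ_smul hg (imAxis s)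
  obtain ⟨k₂, hk₂, f₂⟩ := formQ_smul hg (imAxis t)
  set T := D.vInf (2 * (E.psi E.u).re)
  set δ := D.vInf (nrd (E.psi E.u))
  obtain ⟨C, hC⟩ := exists_abs_le_of_axis hst (T ^ 2 - 4 * δ) T (lt_min hε₁ hε₂)
  obtain ⟨C₁, hC₁⟩ := exists_forall_abs_apply_le (g : Matrix (Fin 2) (Fin 2) ℝ)
  obtain ⟨C₂, hC₂⟩ := exists_forall_abs_apply_le ((g⁻¹ : GL (Fin 2) ℝ) : Matrix (Fin 2) (Fin 2) ℝ)
  have hinj : Function.Injective E.beta := fun w₁ w₂ h =>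
    E.betaMat_injective (congrArg D.iotaInf h)
  refine Set.Finite.of_finite_image (f := E.beta) ((D.finite_of_nrd_eq (nrd (E.psi E.u))
    ((C₁ * C + C₁ * C) * C₂ + (C₁ * C + C₁ * C) * C₂)).subset ?_) hinj.injOn
  rintro _ ⟨w, hw, rfl⟩
  refine ⟨E.beta_mem w, E.nrd_beta w, ?_⟩
  set N := ((g⁻¹ : GL (Fin 2) ℝ) : Matrix (Fin 2) (Fin 2) ℝ) * E.betaMat w * g with hN
  have hMg : E.betaMat w * (g : Matrix (Fin 2) (Fin 2) ℝ) = g * N := by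
    rw [hN, ← mul_assoc, ← mul_assoc, Units.mul_inv, one_mul]
  have hM : D.iotaInf (E.beta w) = g * N * ((g⁻¹ : GL (Fin 2) ℝ) : Matrix (Fin 2) (Fin 2) ℝ) := by
    rw [← hMg, mul_assoc, Units.mul_inv, mul_one]; rfl
  have hdet : N.det = δ := by
    have h1 := congrArg det hMg
    rw [det_mul, det_mul, mul_comm] at h1
    rw [← mul_left_cancel₀ hg.ne' h1, betaMat, D.det_iotaInf, E.nrd_beta]
  have htr : N.trace = T := by
    rw [hN, trace_mul_comm, ← mul_assoc, Units.mul_inv, one_mul, betaMat, beta, map_mul,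
      trace_mul_comm, ← map_mul, ← mul_assoc, Subgroup.coe_inv, Units.inv_mul, one_mul,
      D.trace_iotaInf]
  have hΔ : (N 1 1 - N 0 0) ^ 2 + 4 * N 0 1 * N 1 0 = T ^ 2 - 4 * δ := by
    rw [← hdet, ← htr, det_fin_two, trace_fin_two]; ring
  have hle : formQ N (imAxis s) * formQ N (imAxis t) ≤ 0 := by
    have hw' : formQ (E.betaMat w) (g • imAxis s) * formQ (E.betaMat w) (g • imAxis t) ≤ 0 := hw
    rw [f₁ _ _ hMg, f₂ _ _ hMg, mul_mul_mul_comm] at hw'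
    exact nonpos_of_mul_nonpos_right hw' (mul_pos hk₁ hk₂)
  have hNC := hC N hΔ htr hle (fun h0 => (min_le_left _ _).trans (h₁ w N hMg h0))
    (fun h0 => (min_le_right _ _).trans (h₂ w N hMg h0))
  rw [hM]
  exact abs_mul_apply_le (abs_mul_apply_le hC₁ hNC) hC₂

end OptimalEmbedding

/-! ### The cocycle -/

namespace OptimalEmbedding

variable {F : Type*} [Field F] [NumberField F] {p : ℕ} [Fact p.Prime] {D : Setting F p}
  {K : Type*} [Field K] [NumberField K] [Algebra F K] (E : OptimalEmbedding D K)

theorem exists_formQ_smul (γ : D.Gamma0) (x : HBar) :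
    ∃ k : ℝ, 0 < k ∧ ∀ w, formQ (E.betaMat (γ • w)) (γ • x) = k * formQ (E.betaMat w) x := by
  obtain ⟨k, hk, h⟩ := formQ_smul (D.det_toGLInf_pos γ) x
  exact ⟨k, hk, fun w => h _ _ (E.betaMat_smul γ w)⟩

theorem leftIndicator_smul (γ : D.Gamma0) (w : E.Orbit) (x : HBar) :
    leftIndicator (E.betaMat (γ • w)) (γ • x) = leftIndicator (E.betaMat w) x := by
  obtain ⟨k, hk, h⟩ := E.exists_formQ_smul γ x
  rw [leftIndicator, leftIndicator]
  refine if_congr ?_ rfl rfl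
  rw [h]
  exact ⟨fun h' => (pos_iff_neg_of_mul_neg h').1 hk, mul_neg_of_pos_of_neg hk⟩

variable {E}

theorem IsSeparated.smul {x : HBar} (hx : E.IsSeparated x) (γ : D.Gamma0) :
    E.IsSeparated (γ • x) := by
  rcases hx with ⟨z, rfl⟩ | ⟨ε, hε, h⟩
  · exact Or.inl ⟨γ • z, rfl⟩
  · obtain ⟨k, hk, hf⟩ := E.exists_formQ_smul γ x
    refine Or.inr ⟨k * ε, mul_pos hk hε, fun w => ?_⟩
    rw [← smul_inv_smul γ w, hf, abs_mul, abs_of_pos hk]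
    exact mul_le_mul_of_nonneg_left (h _) hk.le

variable (E)

/-- The signed sum of the points `w_p` over the geodesics `C(w, w')` that separate `x` from `y`. -/
def crossSum (x y : HBar) : D.A0 →₀ ℤ :=
  ∑ᶠ w : E.Orbit, (leftIndicator (E.betaMat w) x - leftIndicator (E.betaMat w) y) •
    Finsupp.single (E.pt w) 1

variable {E}

theorem finite_support_crossSum {x y : HBar} (hx : E.IsSeparated x) (hy : E.IsSeparated y) :
    (Function.support fun w : E.Orbit =>
      (leftIndicator (E.betaMat w) x - leftIndicator (E.betaMat w) y) •
        Finsupp.single (E.pt w) (1 : ℤ)).Finite := by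
  refine (E.finite_formQ_mul_nonpos hx hy).subset fun w hw => ?_
  by_contra hc
  apply hw
  have h : 0 < formQ (E.betaMat w) x * formQ (E.betaMat w) y := not_le.1 hc
  have : leftIndicator (E.betaMat w) x = leftIndicator (E.betaMat w) y := by
    rw [leftIndicator, leftIndicator]
    rcases pos_and_pos_or_neg_and_neg_of_mul_pos h with ⟨h3, h4⟩ | ⟨h3, h4⟩
    · rw [if_neg h3.not_gt, if_neg h4.not_gt]
    · rw [if_pos h3, if_pos h4]
  simp only [this, sub_self, zero_smul]

theorem crossSum_add {x y z : HBar} (hx : E.IsSeparated x) (hy : E.IsSeparated y)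
    (hz : E.IsSeparated z) : E.crossSum x y + E.crossSum y z = E.crossSum x z := by
  rw [crossSum, crossSum, crossSum,
    ← finsum_add_distrib (finite_support_crossSum hx hy) (finite_support_crossSum hy hz)]
  congr 1
  ext1 w
  rw [← add_smul, sub_add_sub_cancel]

theorem divA0_crossSum {x y : HBar} (hx : E.IsSeparated x) (hy : E.IsSeparated y) (γ : D.Gamma0) :
    D.divA0 γ (E.crossSum x y) = E.crossSum (γ • x) (γ • y) := by
  have h1 := AddMonoidHom.map_finsum (D.divA0 γ).toAddMonoidHom (finite_support_crossSum hx hy)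
  change D.divA0 γ (E.crossSum x y) = _ at h1
  rw [h1]
  refine Eq.trans ?_ (finsum_comp_equiv (MulAction.toPerm γ : Equiv.Perm E.Orbit))
  congr 1
  ext1 w
  rw [MulAction.toPerm_apply, leftIndicator_smul, leftIndicator_smul, pt_smul]
  change D.divA0 γ _ = _
  rw [map_smul]
  congr 1
  change Finsupp.lmapDomain ℤ ℤ _ _ = _
  rw [Finsupp.lmapDomain_apply, Finsupp.mapDomain_single]

theorem isSeparated_of_mem_basePoints {x : HBar} (hx : x ∈ E.BasePoints) : E.IsSeparated x :=
  E.isSeparated_of_mem_HStar hx.1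

theorem formQ_ne_zero_of_mem_basePoints {x : HBar} (hx : x ∈ E.BasePoints) (w : E.Orbit) :
    formQ (E.betaMat w) x ≠ 0 := fun h =>
  hx.2 w (((E.isHyperbolic_betaMat w).mem_geodesic_iff x).2 h)

theorem phi_eq_crossSum {x : HBar} (hx : x ∈ E.BasePoints) (γ : D.Gamma0) :
    E.phi x γ = E.crossSum x (γ • x) := by
  rw [phi, crossSum]
  congr 1
  ext1 w
  have hγ : formQ (E.betaMat w) (γ • x) ≠ 0 := by
    obtain ⟨k, hk, hf⟩ := E.exists_formQ_smul γ x
    rw [← smul_inv_smul γ w, hf]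
    exact mul_ne_zero hk.ne' (formQ_ne_zero_of_mem_basePoints hx _)
  rw [delta, (E.isHyperbolic_betaMat w).signedIntersection_eq
    (formQ_ne_zero_of_mem_basePoints hx w) hγ]

theorem phi_mem_Z1 {x : HBar} (hx : x ∈ E.BasePoints) : E.phi x ∈ Z1 D.divA0 := by
  intro g h
  have hs := isSeparated_of_mem_basePoints hx
  rw [phi_eq_crossSum hx, phi_eq_crossSum hx, phi_eq_crossSum hx, divA0_crossSum hs (hs.smul h),
    ← mul_smul, crossSum_add hs (hs.smul g) (hs.smul (g * h))]

/-- The cocycles of two base points `x` and `y` differ by the coboundary of `crossSum x y`. -/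
theorem neg_phi_add_phi_mem_B1 {x y : HBar} (hx : x ∈ E.BasePoints) (hy : y ∈ E.BasePoints) :
    -E.phi x + E.phi y ∈ B1 D.divA0 := by
  have hsx := isSeparated_of_mem_basePoints hx
  have hsy := isSeparated_of_mem_basePoints hy
  refine ⟨E.crossSum x y, fun γ => ?_⟩
  rw [Pi.add_apply, Pi.neg_apply, phi_eq_crossSum hx, phi_eq_crossSum hy, divA0_crossSum hsx hsy]
  have h1 := crossSum_add hsx (hsx.smul γ) (hsy.smul γ)
  have h2 := crossSum_add hsx hsy (hsy.smul γ)
  rw [neg_add_eq_sub, sub_eq_sub_iff_add_eq_add, add_comm (E.crossSum (γ • x) (γ • y)), h1, ← h2,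
    add_comm]

end OptimalEmbedding

end QuatCocycle

end

theorem mainTheorem1 {F : Type*} [Field F] [NumberField F] {p : ℕ} [Fact p.Prime]
    (D : QuatCocycle.Setting F p) {K : Type*} [Field K] [NumberField K] [Algebra F K]
    (E : QuatCocycle.OptimalEmbedding D K) :
    -- `w'` and `w_p` do not depend on the choice of `γ_w`
    (∀ γ₁ γ₂ : D.Gamma0, γ₁ • E.tau = γ₂ • E.tau →
      γ₁ • E.tauConj = γ₂ • E.tauConj ∧ γ₁ • E.tauP = γ₂ • E.tauP) ∧
    -- the sum that defines `φ_ψ(γ)` is finite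
    (∀ x ∈ D.HStar, ∀ γ : D.Gamma0, {w : E.Orbit | E.delta x γ w ≠ 0}.Finite) ∧
    -- `φ_ψ` is a cocycle, whose class does not depend on the base point
    ∃ h : ∀ x ∈ E.BasePoints, E.phi x ∈ QuatCocycle.Z1 D.divA0,
      ∀ (x : QuatCocycle.HBar) (hx : x ∈ E.BasePoints)
        (y : QuatCocycle.HBar) (hy : y ∈ E.BasePoints),
        QuatCocycle.H1.mk D.divA0 ⟨E.phi x, h x hx⟩ =
          QuatCocycle.H1.mk D.divA0 ⟨E.phi y, h y hy⟩ := by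
  refine ⟨fun γ₁ γ₂ h => (E.commute_and_smul_eq_of_smul_tau_eq h).2, fun x hx γ => ?_,
    fun x hx => QuatCocycle.OptimalEmbedding.phi_mem_Z1 hx, fun x hx y hy => ?_⟩
  · have hs := E.isSeparated_of_mem_HStar hx
    exact (E.finite_formQ_mul_nonpos hs (hs.smul γ)).subset fun w hw =>
      (E.isHyperbolic_betaMat w).formQ_mul_nonpos hw
  · exact QuotientAddGroup.eq.2 (QuatCocycle.OptimalEmbedding.neg_phi_add_phi_mem_B1 hx hy)
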